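/- Notation. Let $k\in\{1,2,\dots\}$, let $\gamma_k$ be the standard Gaussian measure on $\mathbb R^k$, and let $H_\alpha(x)=\prod_{i=1}^k H_{\alpha_i}(x_i)$ ($\alpha\in\mathbb N_0^k$) be the orthonormal Hermite polynomials in $L^2(\gamma_k)$, where $H_n(y)=\frac{(-1)^n}{\sqrt{n!}}e^{y^2/2}\frac{d^n}{dy^n}e^{-y^2/2}$. For $f\in L^2(\gamma_k)$ and $\rho\in[-1,1]$ put $$h_{f,f}(\rho)=\sum_{\nu=0}^\infty\Big(\sum_{|\alpha|=\nu}\langle f,H_\alpha\rangle_{\gamma_k}^2\Big)\rho^\nu .$$ A function $\psi$ on $(-1,1)$ is called completely real analytic (at $0$) if it is real analytic on $(-1,1)$ and $\sum_{n}|\psi^{(n)}(0)|/n!<\infty$; then $\psi_{\mathrm{abs}}(x)=\sum_{n}\frac{|\psi^{(n)}(0)|}{n!}x^n$ for $x\in[-1,1]$ and $\widetilde\psi(z)=\sum_n\frac{\psi^{(n)}(0)}{n!}z^n$ for $|z|\le 1$. The real Grothendieck constant $K_G^{\mathbb R}$ is the smallest $K>0$ such that, for all $m,n$, all real $m\times n$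 matrices $(a_{ij})$, all real Hilbert spaces $H$ and all $u_i,v_j$ in the closed unit ball of $H$, $$\Big|\sum_{i,j}a_{ij}\langle u_i,v_j\rangle\Big|\le K\,\sup\Big\{\Big|\sum_{i,j}a_{ij}p_iq_j\Big|:p_i,q_j\in[-1,1]\Big\};$$ it exists. Theorem. Let $k\ge1$ and let $f\in L^\infty(\mathbb R^k)$ be real-valued with $\|f\|_{L^2(\gamma_k)}=1$. Then $\|f\|_\infty\ge1$. Assume now that $f$ is odd. Then $h_{f,f}$ is a bijection of $[-1,1]$ onto itself. Assume also that $h_{f,f}^{-1}|_{(-1,1)}$ is completely real analytic, and write $A=(h_{f,f}^{-1}|_{(-1,1)})_{\mathrm{abs}}$. Then $A(1)>1$, $A$ is a bijection from $[-1,1]$ onto $[-A(1),A(1)]$, and with $h_{f,f}^{\mathrm{hyp}}=A^{-1}:[-A(1),A(1)]\to[-1,1]$ the following hold. (i) $A(y)\ge\frac{\pi}{2}\,\frac{1}{\|f\|_\infty^2}\,y$ for all $y\in[0,1]$. (ii) $h_{f,f}^{\mathrm{hyp}}(1)>0$ and $K_G^{\mathbb R}\le\dfrac{\|f\|_\infty^2}{h_{f,f}^{\mathrm{hyp}}(1)}$.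 If moreover $\operatorname{sign}\big((h_{f,f}^{-1})^{(2n+1)}(0)\big)=(-1)^n$ for all $n\in\mathbb N_0$, then, with $\psi_f=h_{f,f}|_{(-1,1)}$, $$\frac{\|f\|_\infty^2}{h_{f,f}^{\mathrm{hyp}}(1)}=i\,\frac{\|f\|_\infty^2}{\widetilde{\psi_f}(i)},\qquad\text{hence}\qquad K_G^{\mathbb R}\le i\,\frac{\|f\|_\infty^2}{\widetilde{\psi_f}(i)}.$$ (iii) If $\|f\|_\infty=1$, then there is exactly one $\gamma^*=\gamma^*(f)\in(0,1]$ with $$K_G^{\mathbb R}=A(\gamma^*)\le\min\Big\{\frac1{h_{f,f}^{\mathrm{hyp}}(1)},\,A(1)\Big\},$$ and for every real $c_*$ with $1\le c_*<K_G^{\mathbb R}$ one has $0<h_{f,f}^{\mathrm{hyp}}(c_*)<1$ and $\gamma^*\in(h_{f,f}^{\mathrm{hyp}}(c_*),1]$. Finally, $f=\operatorname{sign}$ (with $k=1$) satisfies all these hypotheses, including $\|f\|_\infty=1$, and for it $\dfrac{1}{h_{f,f}^{\mathrm{hyp}}(1)}=\dfrac{\pi}{2\ln(1+\sqrt2)}$,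 so that $K_G^{\mathbb R}\le\dfrac{\pi}{2\ln(1+\sqrt2)}$ (Krivine's bound). -/

import Mathlib

open MeasureTheory ProbabilityTheory Set
open scoped ENNReal Nat

noncomputable section

/-! ### The real Grothendieck constant -/

/-- The norm of a real matrix `A` as a bilinear form on `ℓ_∞ᵐ × ℓ_∞ⁿ`, that is
`sup {|∑ i, ∑ j, a i j * p i * q j| : |p i| ≤ 1, |q j| ≤ 1}`. -/
def normInfOne {m n : ℕ} (A : Matrix (Fin m) (Fin n) ℝ) : ℝ :=
  sSup {s : ℝ | ∃ (p : Fin m → ℝ) (q : Fin n → ℝ), (∀ i, |p i| ≤ 1) ∧ (∀ j, |q j| ≤ 1) ∧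
    s = |∑ i, ∑ j, A i j * p i * q j|}

/-- The set of all absolute constants that are admissible in the real Grothendieck inequality. -/
def grothendieckAdmissible : Set ℝ :=
  {K : ℝ | 0 < K ∧ ∀ (m n : ℕ) (A : Matrix (Fin m) (Fin n) ℝ)
    (H : Type) [NormedAddCommGroup H] [InnerProductSpace ℝ H] [CompleteSpace H]
    (u : Fin m → H) (v : Fin n → H), (∀ i, ‖u i‖ ≤ 1) → (∀ j, ‖v j‖ ≤ 1) →
      |∑ i, ∑ j, A i j * inner ℝ (u i) (v j)| ≤ K * normInfOne A}

/-- The real Grothendieck constant: the smallest admissible constant. -/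
def grothendieckConstant : ℝ := sInf grothendieckAdmissible

/-! ### Completely real analytic functions

A function on an interval around `0` is represented by a total function `ℝ → ℝ`; only its values on
that interval matter. -/

/-- `ψ ∈ W^ω_+((-r, r))`: `ψ` is real analytic on `(-r, r)` and the sequence
`ψ⁽ⁿ⁾(0) / n! * r ^ n` is absolutely summable. -/
def CompletelyRealAnalytic (r : ℝ) (ψ : ℝ → ℝ) : Prop :=
  AnalyticOnNhd ℝ ψ (Ioo (-r) r) ∧
    Summable fun n : ℕ => |iteratedDeriv n ψ 0 / (n ! : ℝ) * r ^ n|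

/-- `ψ_abs(x) = ∑ |ψ⁽ⁿ⁾(0)| / n! * x ^ n`. -/
def absSeries (ψ : ℝ → ℝ) (x : ℝ) : ℝ :=
  ∑' n : ℕ, |iteratedDeriv n ψ 0| / (n ! : ℝ) * x ^ n

/-- The complex extension of `ψ` by its Maclaurin series, `∑ ψ⁽ⁿ⁾(0) / n! * z ^ n`. -/
def complexSeries (ψ : ℝ → ℝ) (z : ℂ) : ℂ :=
  ∑' n : ℕ, ((iteratedDeriv n ψ 0 / (n ! : ℝ) : ℝ) : ℂ) * z ^ n

/-- The inverse of a function which is injective on `[-1, 1]`, defined on its image there. -/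
def invUnit (h : ℝ → ℝ) : ℝ → ℝ := Function.invFunOn h (Icc (-1) 1)

/-- The hyperbolic transform of `ψ`: the inverse of `(ψ⁻¹)_abs`, the latter being regarded as a
function on `[-1, 1]`. -/
def hypTransform (ψ : ℝ → ℝ) : ℝ → ℝ := invUnit (absSeries (invUnit ψ))

/-! ### Gaussian Fourier-Hermite analysis -/

/-- The standard Gaussian measure on `ℝᵏ`. -/
def gaussMeasure (k : ℕ) : Measure (Fin k → ℝ) := Measure.pi fun _ => gaussianReal 0 1

/-- The normalised `k`-variate (probabilists') Hermite polynomial of multi-index `α`. -/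
def hermiteFun {k : ℕ} (α : Fin k → ℕ) (x : Fin k → ℝ) : ℝ :=
  ∏ i, Polynomial.aeval (x i) (Polynomial.hermite (α i)) / √((α i)! : ℝ)

/-- The Fourier-Hermite coefficient `⟨f, H_α⟩` in `L²(γ_k)`. -/
def hermiteCoeff {k : ℕ} (f : (Fin k → ℝ) → ℝ) (α : Fin k → ℕ) : ℝ :=
  ∫ x, f x * hermiteFun α x ∂(gaussMeasure k)

/-- `p_ν(f, g) = ∑_{|α| = ν} ⟨f, H_α⟩ ⟨g, H_α⟩`. -/
def corrCoeff {k : ℕ} (f g : (Fin k → ℝ) → ℝ) (ν : ℕ) : ℝ :=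
  ∑ α ∈ Finset.piAntidiag (Finset.univ : Finset (Fin k)) ν, hermiteCoeff f α * hermiteCoeff g α

/-- The function `h_{f,g}(ρ) = ∑ p_ν(f, g) ρ ^ ν`, for `ρ ∈ [-1, 1]`. -/
def corrFun {k : ℕ} (f g : (Fin k → ℝ) → ℝ) (ρ : ℝ) : ℝ :=
  ∑' ν : ℕ, corrCoeff f g ν * ρ ^ ν

/-- The essential supremum norm of `f`. -/
def linftyNorm {k : ℕ} (f : (Fin k → ℝ) → ℝ) : ℝ := (eLpNorm f ∞ (gaussMeasure k)).toReal

/-- `f` is odd (almost everywhere). -/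
def IsOddAE {k : ℕ} (f : (Fin k → ℝ) → ℝ) : Prop :=
  ∀ᵐ x ∂(gaussMeasure k), f (-x) = -f x

/-- The sign function, as a function on `ℝ¹`. -/
def signFun (x : Fin 1 → ℝ) : ℝ := Real.sign (x 0)

end

/-! The core is a rounding scheme. If X and Y are standard Gaussian vectors in ℝ^k whose coordinates
have cross-correlation r, then E[H_α(X) H_β(Y)] is r^|α| for α = β and 0 otherwise. Since the
Hermite polynomials are complete in L², expanding f gives E[f(X) f(Y)] = h(r)
(`integral_gaussProj_mul_gaussProj`). For odd f of norm one, h has nonnegative coefficients p_ν of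
sum one and no even terms, so it is an increasing bijection of [-1,1]. Let b_n be the Maclaurin
coefficients of the inverse of h, so that A has coefficients |b_n|, and let c satisfy A(c) = 1.
Following Krivine, u_i and v_j are replaced by the direct sums over n of √(|b_n| c^n) u_i^{⊗n} and
sign(b_n) √(|b_n| c^n) v_j^{⊗n}. These are unit vectors because A(c) = 1, and their inner products
are h⁻¹(c⟨u_i, v_j⟩) (`exists_krivine_vectors`, phrased with Gram matrices and the Schur product
theorem). Evaluating f/‖f‖_∞ at the corresponding Gaussian vectors gives random numbers in [-1,1]
with mean products c⟨u_i, v_j⟩/‖f‖_∞². Averaging the bilinear form yields the bound ‖f‖_∞²/c. The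
linear bound on A keeps only its first term: b_1 = 1/p_1, and p_1 ≤ (2/π)‖f‖_∞² because √p_1 is the
pairing of f with a standard Gaussian linear functional, whose absolute mean is √(2/π). Strictness
A(1) > 1 comes from p_1 < 1: equality would make f linear, hence unbounded. Under the sign condition
the complex inverse series sends ic to iA(c) = i, so the complex extension of h sends i to ic. For
norm one, A(c) ≤ cA(1) gives K ≤ 1/c ≤ A(1), so K lies in the range of A. For the sign function, the
coefficient recurrence is that of arcsine. Hence h⁻¹(x) = sin(πx/2), A(x) = sinh(πx/2) and c = (2/π)
ln(1+√2). This case also shows that an admissible constant exists at all. -/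

/-! ### Hermite polynomials and the one-dimensional Gaussian measure -/

/-- The probabilists' Hermite polynomials with real coefficients. -/
noncomputable def hermiteReal (n : ℕ) : Polynomial ℝ :=
  (Polynomial.hermite n).map (Int.castRingHom ℝ)

theorem aeval_hermite (n : ℕ) (x : ℝ) :
    Polynomial.aeval x (Polynomial.hermite n) = (hermiteReal n).eval x := by
  simp [hermiteReal, Polynomial.aeval_def, Polynomial.eval_map]

theorem hermiteReal_zero : hermiteReal 0 = 1 := by simp [hermiteReal]

theorem hermiteReal_one : hermiteReal 1 = Polynomial.X := by simp [hermiteReal]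

theorem hermiteReal_succ (n : ℕ) :
    hermiteReal (n + 1) = Polynomial.X * hermiteReal n - (hermiteReal n).derivative := by
  simp [hermiteReal, Polynomial.hermite_succ, Polynomial.derivative_map]

theorem derivative_hermiteReal_succ (n : ℕ) :
    (hermiteReal (n + 1)).derivative = ((n : ℝ) + 1) • hermiteReal n := by
  induction n with
  | zero => simp [hermiteReal_one, hermiteReal_zero]
  | succ n ih =>
    rw [hermiteReal_succ (n + 1), ih, Polynomial.derivative_sub, Polynomial.derivative_mul, ih,
      Polynomial.derivative_smul]
    conv_rhs => rw [hermiteReal_succ n]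
    simp only [Polynomial.derivative_X, one_mul, Polynomial.smul_eq_C_mul, Nat.cast_add,
      Nat.cast_one, map_add, map_one]
    rw [hermiteReal_succ n]
    ring

theorem eval_neg_hermiteReal (n : ℕ) (x : ℝ) :
    (hermiteReal n).eval (-x) = (-1) ^ n * (hermiteReal n).eval x := by
  have : (hermiteReal n).comp (-Polynomial.X) = (-1) ^ n * hermiteReal n := by
    induction n with
    | zero => simp [hermiteReal_zero]
    | succ n ih =>
      -- The recurrence for the next polynomial also involves the derivative, so the parity identity
      -- is needed in differentiated form too.
      have h := congrArg Polynomial.derivative ih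
      rw [Polynomial.derivative_comp] at h
      have e : ((-1 : Polynomial ℝ) ^ n) = Polynomial.C ((-1) ^ n) := by simp
      rw [e, Polynomial.derivative_C_mul, ← e] at h
      rw [hermiteReal_succ, Polynomial.sub_comp, Polynomial.mul_comp, Polynomial.X_comp, ih]
      simp only [Polynomial.derivative_neg, Polynomial.derivative_X] at h
      linear_combination h
  have h := congrArg (Polynomial.eval x) this
  simpa [Polynomial.eval_comp] using h

/-- The standard Gaussian measure on the line. -/
noncomputable abbrev stdGauss : Measure ℝ := gaussianReal 0 1

theorem memLp_polynomial_stdGauss (p : Polynomial ℝ) (q : ℝ≥0∞) (hq : q ≠ ∞) :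
    MemLp (fun x => p.eval x) q stdGauss := by
  have hpow : ∀ n : ℕ, ∀ q : ℝ≥0∞, q ≠ ∞ → MemLp (fun x : ℝ => x ^ n) q stdGauss := by
    intro n
    induction n with
    | zero => intro q _; simpa using memLp_const (1 : ℝ)
    | succ n ih =>
      intro q hq
      have h1 := ih (2 * q) (ENNReal.mul_ne_top (by simp) hq)
      have h2 : MemLp id (2 * q) stdGauss :=
        memLp_id_gaussianReal' _ (ENNReal.mul_ne_top (by simp) hq)
      -- Each power is the product of the previous one and the identity, both in L^{2q}; Hölder then
      -- lands in L^q.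
      have : ENNReal.HolderTriple (2 * q) (2 * q) q := ⟨by
        rw [ENNReal.mul_inv (by simp) (by simp), ← two_mul, ← mul_assoc,
          ENNReal.mul_inv_cancel (by simp) (by simp), one_mul]⟩
      have := h2.mul h1 (r := q)
      refine this.congr_norm (by fun_prop) (ae_of_all _ fun x => ?_)
      simp [pow_succ]
  have h : MemLp (fun x => ∑ i ∈ p.support, p.coeff i * x ^ i) q stdGauss :=
    memLp_finsetSum _ fun i _ => (hpow i q hq).const_mul _
  simpa [Polynomial.eval_eq_sum, Polynomial.sum] using h

theorem integrable_polynomial_stdGauss (p : Polynomial ℝ) :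
    Integrable (fun x => p.eval x) stdGauss :=
  memLp_one_iff_integrable.1 (memLp_polynomial_stdGauss p 1 (by simp))

theorem integrable_polynomial_mul_gaussianPDFReal (p : Polynomial ℝ) :
    Integrable fun x => gaussianPDFReal 0 1 x * p.eval x := by
  have h := integrable_polynomial_stdGauss p
  rw [stdGauss, gaussianReal_of_var_ne_zero _ one_ne_zero,
    integrable_withDensity_iff_integrable_smul' (measurable_gaussianPDF _ _)
      (ae_of_all _ fun x => gaussianPDF_lt_top)] at h
  simpa [toReal_gaussianPDF] using h

theorem hasDerivAt_gaussianPDFReal_mul_polynomial (p : Polynomial ℝ) (x : ℝ) :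
    HasDerivAt (fun x => gaussianPDFReal 0 1 x * p.eval x)
      (gaussianPDFReal 0 1 x * (p.derivative - Polynomial.X * p).eval x) x := by
  have h1 : HasDerivAt (gaussianPDFReal 0 1) (gaussianPDFReal 0 1 x * (-x)) x := by
    have : HasDerivAt (fun y : ℝ => -(y - 0) ^ 2 / (2 * ((1 : NNReal) : ℝ))) (-x) x := by
      have := (((hasDerivAt_id x).sub_const 0).pow 2).neg.div_const (2 * ((1 : NNReal) : ℝ))
      exact this.congr_deriv (by simp; ring)
    have := (this.exp).const_mul ((√(2 * Real.pi * (1 : NNReal)))⁻¹)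
    rw [gaussianPDFReal_def]
    exact this.congr_deriv (by ring)
  exact (h1.mul (p.hasDerivAt x)).congr_deriv (by simp; ring)

/-- Gaussian integration by parts: the density φ satisfies φ' = -xφ, so φ(p' - xp) is the derivative
of φp and integrates to zero. -/
theorem integral_mul_polynomial_stdGauss (p : Polynomial ℝ) :
    ∫ x, (Polynomial.X * p).eval x ∂stdGauss = ∫ x, p.derivative.eval x ∂stdGauss := by
  have h := integral_eq_zero_of_hasDerivAt_of_integrable
    (hasDerivAt_gaussianPDFReal_mul_polynomial p)
    (integrable_polynomial_mul_gaussianPDFReal _) (integrable_polynomial_mul_gaussianPDFReal _)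
  have e : ∫ x, (p.derivative - Polynomial.X * p).eval x ∂stdGauss = 0 := by
    rw [stdGauss, integral_gaussianReal_eq_integral_smul one_ne_zero]
    simpa only [smul_eq_mul] using h
  simp only [Polynomial.eval_sub] at e
  rw [integral_sub (integrable_polynomial_stdGauss _) (integrable_polynomial_stdGauss _)] at e
  linarith

/-- -φH_n is an antiderivative of φH_{n+1}. This evaluates the Hermite coefficients of the sign
function and, for n = 0, the mean of |y|. -/
theorem integral_Ioi_gaussianPDFReal_mul_hermiteReal_succ (n : ℕ) :
    ∫ x in Ioi 0, gaussianPDFReal 0 1 x * (hermiteReal (n + 1)).eval x =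
      gaussianPDFReal 0 1 0 * (hermiteReal n).eval 0 := by
  have hd := hasDerivAt_gaussianPDFReal_mul_polynomial (hermiteReal n)
  have hi := integrable_polynomial_mul_gaussianPDFReal
    ((hermiteReal n).derivative - Polynomial.X * hermiteReal n)
  have h := integral_Ioi_of_hasDerivAt_of_tendsto (a := 0) (hd 0).continuousAt.continuousWithinAt
    (fun x _ => hd x) hi.integrableOn
    (tendsto_zero_of_hasDerivAt_of_integrableOn_Ioi (a := 0) (fun x _ => hd x) hi.integrableOn
      (integrable_polynomial_mul_gaussianPDFReal _).integrableOn)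
  have e : ∀ x, gaussianPDFReal 0 1 x * (hermiteReal (n + 1)).eval x =
      -(gaussianPDFReal 0 1 x *
        ((hermiteReal n).derivative - Polynomial.X * hermiteReal n).eval x) := by
    intro x
    rw [hermiteReal_succ]
    simp
    ring
  simp only [e]
  rw [integral_neg, h]
  ring

/-- Orthogonality of the Hermite polynomials. -/
theorem integral_hermiteReal_mul_hermiteReal (m n : ℕ) :
    ∫ x, (hermiteReal m).eval x * (hermiteReal n).eval x ∂stdGauss =
      if m = n then (n ! : ℝ) else 0 := by
  -- The raising operator X - d/dx is adjoint to d/dx under the Gaussian measure, so an index on the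
  -- left is traded for a derivative on the right.
  have key : ∀ (m : ℕ) (q : Polynomial ℝ),
      ∫ x, (hermiteReal (m + 1) * q).eval x ∂stdGauss =
        ∫ x, (hermiteReal m * q.derivative).eval x ∂stdGauss := by
    intro m q
    have h := integral_mul_polynomial_stdGauss (hermiteReal m * q)
    have e : hermiteReal (m + 1) * q = Polynomial.X * (hermiteReal m * q)
        - (hermiteReal m).derivative * q := by
      rw [hermiteReal_succ]; ring
    rw [e]
    simp only [Polynomial.eval_sub]
    rw [integral_sub (integrable_polynomial_stdGauss _) (integrable_polynomial_stdGauss _), h,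
      Polynomial.derivative_mul]
    simp only [Polynomial.eval_add]
    rw [integral_add (integrable_polynomial_stdGauss _) (integrable_polynomial_stdGauss _)]
    ring
  have main : ∀ m n : ℕ, ∫ x, (hermiteReal m * hermiteReal n).eval x ∂stdGauss =
      if m = n then (n ! : ℝ) else 0 := by
    intro m
    induction m with
    | zero =>
      rintro (_ | n)
      · simp [hermiteReal_zero]
      · rw [mul_comm, key]
        simp [hermiteReal_zero]
    | succ m ih =>
      rintro (_ | n)
      · rw [key]
        simp [hermiteReal_zero]
      · rw [key, derivative_hermiteReal_succ]
        simp only [mul_smul_comm, Polynomial.eval_smul, smul_eq_mul]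
        rw [integral_const_mul, ih]
        split_ifs <;> simp_all [Nat.factorial_succ]
  simpa only [Polynomial.eval_mul] using main m n

/-- The Ornstein-Uhlenbeck operators act diagonally on the Hermite polynomials. -/
theorem integral_hermiteReal_affine {r s : ℝ} (hrs : r ^ 2 + s ^ 2 = 1) (n : ℕ) (x : ℝ) :
    ∫ z, (hermiteReal n).eval (r * x + s * z) ∂stdGauss = r ^ n * (hermiteReal n).eval x := by
  set l : Polynomial ℝ := Polynomial.C (r * x) + Polynomial.C s * Polynomial.X with hl
  have hle : ∀ z, l.eval z = r * x + s * z := by intro z; simp [hl]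
  have hld : l.derivative = Polynomial.C s := by simp [hl]
  suffices h : ∀ n, ∫ z, ((hermiteReal n).comp l).eval z ∂stdGauss =
      r ^ n * (hermiteReal n).eval x by
    simpa only [Polynomial.eval_comp, hle] using h n
  have int := integrable_polynomial_stdGauss
  -- Integrating the recurrence by parts in z, the two derivative terms combine with the factor s² -
  -- 1 = -r², which leaves the Hermite recurrence scaled by powers of r.
  have step : ∀ n, ∫ z, ((hermiteReal (n + 1)).comp l).eval z ∂stdGauss =
      r * x * ∫ z, ((hermiteReal n).comp l).eval z ∂stdGauss -
        r ^ 2 * ∫ z, ((hermiteReal n).derivative.comp l).eval z ∂stdGauss := by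
    intro n
    have e : (hermiteReal (n + 1)).comp l = (r * x) • (hermiteReal n).comp l +
        s • (Polynomial.X * (hermiteReal n).comp l) - (hermiteReal n).derivative.comp l := by
      rw [hermiteReal_succ, Polynomial.sub_comp, Polynomial.mul_comp, Polynomial.X_comp]
      simp only [Polynomial.smul_eq_C_mul]
      conv_lhs => enter [1, 1]; rw [hl]
      ring
    have st := integral_mul_polynomial_stdGauss ((hermiteReal n).comp l)
    rw [Polynomial.derivative_comp, hld] at st
    have e2 : ∀ z, (Polynomial.C s * (hermiteReal n).derivative.comp l).eval z =
      s * ((hermiteReal n).derivative.comp l).eval z := by intro z; simp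
    simp only [e2] at st
    rw [integral_const_mul] at st
    have e3 : ∀ z, ((hermiteReal (n + 1)).comp l).eval z =
        (r * x) * ((hermiteReal n).comp l).eval z +
        s * (Polynomial.X * (hermiteReal n).comp l).eval z -
          ((hermiteReal n).derivative.comp l).eval z := by
      intro z; rw [e]; simp only [Polynomial.eval_sub, Polynomial.eval_add, Polynomial.eval_smul,
        smul_eq_mul]
    simp only [e3]
    have i12 : Integrable (fun z => r * x * ((hermiteReal n).comp l).eval z +
        s * (Polynomial.X * (hermiteReal n).comp l).eval z) stdGauss :=
      ((int _).const_mul _).add ((int _).const_mul _)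
    rw [integral_sub i12 (int _),
      integral_add ((int _).const_mul _) ((int _).const_mul _), integral_const_mul,
      integral_const_mul, st]
    have : s ^ 2 = 1 - r ^ 2 := by linarith
    linear_combination (∫ z, ((hermiteReal n).derivative.comp l).eval z ∂stdGauss) * this
  intro n
  induction n using Nat.strong_induction_on with
  | _ n ih =>
    rcases n with _ | _ | n
    · simp [hermiteReal_zero]
    · rw [step 0]; simp [hermiteReal_zero, hermiteReal_one]
    · rw [step (n + 1), ih (n + 1) (by omega), hermiteReal_succ (n + 1),
        derivative_hermiteReal_succ]
      simp only [Polynomial.smul_comp, Polynomial.eval_smul, smul_eq_mul, Polynomial.eval_sub,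
        Polynomial.eval_mul, Polynomial.eval_X]
      rw [integral_const_mul, ih n (by omega)]
      ring

/-! ### Linear functionals of Gaussian vectors -/

/-- The standard Gaussian measure on `ι → ℝ`. -/
noncomputable abbrev stdGaussPi (ι : Type*) [Fintype ι] : Measure (ι → ℝ) :=
  Measure.pi fun _ : ι => stdGauss

theorem integral_cexp_sum_stdGaussPi {ι : Type*} [Fintype ι] (c : ι → ℝ) :
    ∫ g : ι → ℝ, Complex.exp (((∑ l, c l * g l : ℝ) : ℂ) * Complex.I) ∂stdGaussPi ι =
      Complex.exp (-((∑ l, c l ^ 2 : ℝ) : ℂ) / 2) := by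
  have h : ∀ g : ι → ℝ, Complex.exp (((∑ l, c l * g l : ℝ) : ℂ) * Complex.I) =
      ∏ l, Complex.exp ((c l : ℂ) * (g l : ℂ) * Complex.I) := by
    intro g
    rw [← Complex.exp_sum]
    push_cast
    rw [Finset.sum_mul]
  simp only [h]
  rw [integral_fintype_prod_eq_prod
    (fun l (x : ℝ) => Complex.exp ((c l : ℂ) * (x : ℂ) * Complex.I))]
  have h2 : ∀ l, ∫ x : ℝ, Complex.exp ((c l : ℂ) * (x : ℂ) * Complex.I) ∂stdGauss =
      Complex.exp (-(c l : ℂ) ^ 2 / 2) := by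
    intro l
    rw [← charFun_apply_real, charFun_gaussianReal]
    congr 1
    simp
    ring
  simp only [h2]
  rw [← Complex.exp_sum]
  push_cast
  rw [← Finset.sum_div, Finset.sum_neg_distrib]

theorem measurePreserving_dotProduct_stdGaussPi {ι : Type*} [Fintype ι] {w : ι → ℝ}
    (hw : ∑ l, w l ^ 2 = 1) :
    MeasurePreserving (fun g : ι → ℝ => ∑ l, w l * g l) (stdGaussPi ι) stdGauss := by
  have hm : Measurable (fun g : ι → ℝ => ∑ l, w l * g l) := by fun_prop
  refine ⟨hm, ?_⟩
  have := Measure.isProbabilityMeasure_map (μ := stdGaussPi ι) hm.aemeasurable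
  apply Measure.ext_of_charFun
  ext t
  rw [charFun_gaussianReal, charFun_apply_real, integral_map hm.aemeasurable (by fun_prop)]
  have h := integral_cexp_sum_stdGaussPi (fun l => t * w l)
  simp only [mul_pow, ← Finset.mul_sum, hw, mul_assoc] at h
  have e : ∀ g : ι → ℝ, (t : ℂ) * ((∑ l, w l * g l : ℝ) : ℂ) * Complex.I =
    ((t * ∑ l, w l * g l : ℝ) : ℂ) * Complex.I := by intro g; push_cast; ring
  simp only [e]
  rw [h]
  congr 1
  push_cast
  simp
  ring

/-- The joint law of two linear functionals of a Gaussian vector depends on their correlation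
only. -/
theorem map_dotProduct_prodMk_stdGaussPi {ι : Type*} [Fintype ι] {w w' : ι → ℝ} {r s : ℝ}
    (hw : ∑ l, w l ^ 2 = 1) (hw' : ∑ l, w' l ^ 2 = 1) (hr : ∑ l, w l * w' l = r)
    (hrs : r ^ 2 + s ^ 2 = 1) :
    (stdGaussPi ι).map (fun g => (∑ l, w l * g l, ∑ l, w' l * g l)) =
      (stdGauss.prod stdGauss).map fun p => (p.1, r * p.1 + s * p.2) := by
  have hm : Measurable (fun g : ι → ℝ => (∑ l, w l * g l, ∑ l, w' l * g l)) := by fun_prop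
  have hm' : Measurable (fun p : ℝ × ℝ => (p.1, r * p.1 + s * p.2)) := by fun_prop
  have := Measure.isProbabilityMeasure_map (μ := stdGaussPi ι) hm.aemeasurable
  have := Measure.isProbabilityMeasure_map (μ := stdGauss.prod stdGauss) hm'.aemeasurable
  apply Measure.ext_of_charFunDual
  ext L
  rw [charFunDual_apply, charFunDual_apply, integral_map hm.aemeasurable (by fun_prop),
    integral_map hm'.aemeasurable (by fun_prop)]
  have hL : ∀ x y : ℝ, L (x, y) = L (1, 0) * x + L (0, 1) * y := by
    intro x y
    have : ((x, y) : ℝ × ℝ) = x • (1, 0) + y • (0, 1) := by simp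
    rw [this, map_add, map_smul, map_smul, smul_eq_mul, smul_eq_mul]
    ring
  set a := L (1, 0)
  set b := L (0, 1)
  have e1 : ∀ g : ι → ℝ, L (∑ l, w l * g l, ∑ l, w' l * g l) =
      ∑ l, (a * w l + b * w' l) * g l := by
    intro g
    rw [hL, Finset.mul_sum, Finset.mul_sum, ← Finset.sum_add_distrib]
    exact Finset.sum_congr rfl fun _ _ => by ring
  have e2 : ∀ p : ℝ × ℝ, Complex.exp ((L (p.1, r * p.1 + s * p.2) : ℂ) * Complex.I) =
      Complex.exp (((a + b * r : ℝ) : ℂ) * p.1 * Complex.I) *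
        Complex.exp (((b * s : ℝ) : ℂ) * p.2 * Complex.I) := by
    intro p
    rw [hL, ← Complex.exp_add]
    congr 1
    push_cast
    ring
  simp only [e1, e2]
  rw [integral_cexp_sum_stdGaussPi,
    integral_prod_mul (fun x : ℝ => Complex.exp (((a + b * r : ℝ) : ℂ) * x * Complex.I))
      (fun x : ℝ => Complex.exp (((b * s : ℝ) : ℂ) * x * Complex.I)),
    ← charFun_apply_real, ← charFun_apply_real, charFun_gaussianReal, charFun_gaussianReal,
    ← Complex.exp_add]
  have hsum : ∑ l, (a * w l + b * w' l) ^ 2 = a ^ 2 + 2 * a * b * r + b ^ 2 := by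
    have : ∀ l, (a * w l + b * w' l) ^ 2 =
      a ^ 2 * w l ^ 2 + 2 * a * b * (w l * w' l) + b ^ 2 * w' l ^ 2 := fun l => by ring
    simp only [this, Finset.sum_add_distrib, ← Finset.mul_sum, hw, hw', hr]
    ring
  rw [hsum]
  -- The right-hand exponent contains (a + br)² + (bs)², which equals a² + 2abr + b² exactly because
  -- s² = 1 - r².
  have hc : (s : ℂ) ^ 2 = 1 - (r : ℂ) ^ 2 := by
    have : s ^ 2 = 1 - r ^ 2 := by linarith
    exact_mod_cast this
  congr 1
  push_cast
  linear_combination (b : ℂ) ^ 2 / 2 * hc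

/-- The correlation of Hermite polynomials of two correlated standard Gaussian variables. -/
theorem integral_hermiteReal_dotProduct {ι : Type*} [Fintype ι] {w w' : ι → ℝ} {r : ℝ}
    (hw : ∑ l, w l ^ 2 = 1) (hw' : ∑ l, w' l ^ 2 = 1) (hr : ∑ l, w l * w' l = r) (m n : ℕ) :
    ∫ g, (hermiteReal m).eval (∑ l, w l * g l) * (hermiteReal n).eval (∑ l, w' l * g l)
      ∂stdGaussPi ι = if m = n then (n ! : ℝ) * r ^ n else 0 := by
  have hr1 : r ^ 2 ≤ 1 := by
    have := Finset.sum_mul_sq_le_sq_mul_sq Finset.univ w w'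
    rwa [hw, hw', hr, one_mul] at this
  obtain ⟨s, hs⟩ : ∃ s : ℝ, r ^ 2 + s ^ 2 = 1 :=
    ⟨√(1 - r ^ 2), by rw [Real.sq_sqrt (by linarith)]; ring⟩
  have hlaw := map_dotProduct_prodMk_stdGaussPi hw hw' hr hs
  have hm : Measurable (fun g : ι → ℝ => (∑ l, w l * g l, ∑ l, w' l * g l)) := by fun_prop
  have hm' : Measurable (fun p : ℝ × ℝ => (p.1, r * p.1 + s * p.2)) := by fun_prop
  have hF : Continuous fun p : ℝ × ℝ => (hermiteReal m).eval p.1 * (hermiteReal n).eval p.2 := by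
    fun_prop
  have hint : Integrable (fun g : ι → ℝ => (hermiteReal m).eval (∑ l, w l * g l) *
      (hermiteReal n).eval (∑ l, w' l * g l)) (stdGaussPi ι) :=
    ((memLp_polynomial_stdGauss _ 2 (by simp)).comp_measurePreserving
      (measurePreserving_dotProduct_stdGaussPi hw)).integrable_mul
      ((memLp_polynomial_stdGauss _ 2 (by simp)).comp_measurePreserving
      (measurePreserving_dotProduct_stdGaussPi hw'))
  have hint' : Integrable (fun p : ℝ × ℝ => (hermiteReal m).eval p.1 *
      (hermiteReal n).eval (r * p.1 + s * p.2)) (stdGauss.prod stdGauss) := by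
    have := (integrable_map_measure hF.aestronglyMeasurable hm.aemeasurable).2 hint
    rw [hlaw] at this
    exact (integrable_map_measure hF.aestronglyMeasurable hm'.aemeasurable).1 this
  have h1 := integral_map (μ := stdGaussPi ι) hm.aemeasurable
    (hF.aestronglyMeasurable (μ := (stdGaussPi ι).map _))
  rw [hlaw, integral_map hm'.aemeasurable hF.aestronglyMeasurable] at h1
  -- With the first variable frozen, the inner integral is the Ornstein-Uhlenbeck action, and
  -- orthogonality finishes.
  rw [← h1, integral_prod _ hint']
  simp only [integral_const_mul, integral_hermiteReal_affine hs]
  have h2 : ∀ x, (hermiteReal m).eval x * (r ^ n * (hermiteReal n).eval x) =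
    r ^ n * ((hermiteReal m).eval x * (hermiteReal n).eval x) := fun x => by ring
  simp only [h2, integral_const_mul, integral_hermiteReal_mul_hermiteReal]
  split_ifs
  · ring
  · simp

/-! ### Multivariate Hermite polynomials -/

instance isProbabilityMeasure_gaussMeasure (k : ℕ) : IsProbabilityMeasure (gaussMeasure k) := by
  unfold gaussMeasure; infer_instance

theorem hermiteFun_eq_prod {k : ℕ} (α : Fin k → ℕ) (x : Fin k → ℝ) :
    hermiteFun α x = (∏ i, √((α i)! : ℝ))⁻¹ * ∏ i, (hermiteReal (α i)).eval (x i) := by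
  simp only [hermiteFun, aeval_hermite, Finset.prod_div_distrib]
  rw [div_eq_inv_mul]

theorem memLp_prod_polynomial_gaussMeasure {k : ℕ} (p : Fin k → Polynomial ℝ) :
    MemLp (fun x : Fin k → ℝ => ∏ i, (p i).eval (x i)) 2 (gaussMeasure k) := by
  have hc : Continuous fun x : Fin k → ℝ => ∏ i, (p i).eval (x i) := by fun_prop
  rw [memLp_two_iff_integrable_sq hc.aestronglyMeasurable]
  simp only [← Finset.prod_pow]
  refine Integrable.fintype_prod (f := fun i (y : ℝ) => (p i).eval y ^ 2) fun i => ?_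
  exact (integrable_polynomial_stdGauss (p i ^ 2)).congr
    (ae_of_all _ fun y => Polynomial.eval_pow 2)

theorem memLp_hermiteFun {k : ℕ} (α : Fin k → ℕ) : MemLp (hermiteFun α) 2 (gaussMeasure k) := by
  have h := (memLp_prod_polynomial_gaussMeasure fun i => hermiteReal (α i)).const_mul
    (∏ i, √((α i)! : ℝ))⁻¹
  exact h.ae_eq (ae_of_all _ fun x => (hermiteFun_eq_prod α x).symm)

/-- One differing index kills the product; otherwise the factorials cancel the normalisations. The
case r = 1 gives orthonormality. -/
theorem prod_ite_factorial_mul_pow {k : ℕ} (α β : Fin k → ℕ) (r : ℝ) :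
    ((∏ i, √((α i)! : ℝ))⁻¹ * (∏ i, √((β i)! : ℝ))⁻¹) *
      ∏ i, (if α i = β i then ((β i)! : ℝ) * r ^ β i else 0) =
      if α = β then r ^ ∑ i, α i else 0 := by
  by_cases h : α = β
  · subst h
    simp only [if_true, Finset.prod_mul_distrib, Finset.prod_pow_eq_pow_sum]
    have h0 : (∏ i, √((α i)! : ℝ)) ≠ 0 := Finset.prod_ne_zero_iff.2 fun i _ => by positivity
    have h1 : ∏ i, ((α i)! : ℝ) = (∏ i, √((α i)! : ℝ)) * ∏ i, √((α i)! : ℝ) := by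
      rw [← Finset.prod_mul_distrib]
      exact Finset.prod_congr rfl fun i _ => (Real.mul_self_sqrt (by positivity)).symm
    rw [h1]
    field_simp
  · rw [if_neg h]
    obtain ⟨i, hi⟩ := Function.ne_iff.1 h
    rw [mul_eq_zero]
    exact Or.inr (Finset.prod_eq_zero (Finset.mem_univ i) (if_neg hi))

/-- Evaluation of `k` independent copies of a Gaussian vector at a linear functional. -/
def gaussProj {ι : Type*} [Fintype ι] (k : ℕ) (w : ι → ℝ) (g : Fin k → ι → ℝ) : Fin k → ℝ :=
  fun i => ∑ l, w l * g i l

/-- The law of `k` independent standard Gaussian vectors in `ι → ℝ`. -/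
noncomputable abbrev gaussArray (k : ℕ) (ι : Type*) [Fintype ι] : Measure (Fin k → ι → ℝ) :=
  Measure.pi fun _ => stdGaussPi ι

theorem measurePreserving_gaussProj {ι : Type*} [Fintype ι] (k : ℕ) {w : ι → ℝ}
    (hw : ∑ l, w l ^ 2 = 1) :
    MeasurePreserving (gaussProj k w) (gaussArray k ι) (gaussMeasure k) :=
  measurePreserving_pi _ _ fun _ => measurePreserving_dotProduct_stdGaussPi hw

theorem integral_hermiteFun_gaussProj {ι : Type*} [Fintype ι] {k : ℕ} {w w' : ι → ℝ} {r : ℝ}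
    (hw : ∑ l, w l ^ 2 = 1) (hw' : ∑ l, w' l ^ 2 = 1) (hr : ∑ l, w l * w' l = r)
    (α β : Fin k → ℕ) :
    ∫ g, hermiteFun α (gaussProj k w g) * hermiteFun β (gaussProj k w' g) ∂gaussArray k ι =
      if α = β then r ^ ∑ i, α i else 0 := by
  have h : ∀ g : Fin k → ι → ℝ,
      hermiteFun α (gaussProj k w g) * hermiteFun β (gaussProj k w' g) =
      ((∏ i, √((α i)! : ℝ))⁻¹ * (∏ i, √((β i)! : ℝ))⁻¹) *
      ∏ i, ((hermiteReal (α i)).eval (∑ l, w l * g i l) *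
        (hermiteReal (β i)).eval (∑ l, w' l * g i l)) := by
    intro g
    rw [hermiteFun_eq_prod, hermiteFun_eq_prod, Finset.prod_mul_distrib]
    simp only [gaussProj]
    ring
  simp only [h]
  rw [integral_const_mul, integral_fintype_prod_eq_prod (fun i (y : ι → ℝ) =>
    (hermiteReal (α i)).eval (∑ l, w l * y l) * (hermiteReal (β i)).eval (∑ l, w' l * y l))]
  simp only [integral_hermiteReal_dotProduct hw hw' hr]
  exact prod_ite_factorial_mul_pow α β r

theorem integral_hermiteFun_mul_hermiteFun {k : ℕ} (α β : Fin k → ℕ) :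
    ∫ x, hermiteFun α x * hermiteFun β x ∂gaussMeasure k = if α = β then 1 else 0 := by
  have h : ∀ x : Fin k → ℝ, hermiteFun α x * hermiteFun β x =
      ((∏ i, √((α i)! : ℝ))⁻¹ * (∏ i, √((β i)! : ℝ))⁻¹) *
      ∏ i, ((hermiteReal (α i)).eval (x i) * (hermiteReal (β i)).eval (x i)) := by
    intro g
    rw [hermiteFun_eq_prod, hermiteFun_eq_prod, Finset.prod_mul_distrib]
    ring
  simp only [h, gaussMeasure]
  rw [integral_const_mul, integral_fintype_prod_eq_prod (fun i (y : ℝ) =>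
    (hermiteReal (α i)).eval y * (hermiteReal (β i)).eval y)]
  simp only [integral_hermiteReal_mul_hermiteReal]
  simpa using prod_ite_factorial_mul_pow α β 1

/-! ### Completeness of the Hermite polynomials -/

/-- The Hermite polynomials as a polynomial sequence. -/
noncomputable def hermiteSequence : Polynomial.Sequence ℝ where
  elems' := hermiteReal
  degree_eq' n := by
    rw [hermiteReal, (Polynomial.hermite_monic n).degree_map, Polynomial.degree_hermite]

/-- The Hermite polynomials as a basis of the space of polynomials. -/
noncomputable def hermiteBasis : Module.Basis ℕ ℝ (Polynomial ℝ) :=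
  hermiteSequence.basis fun n => by
    have : (hermiteReal n).Monic := (Polynomial.hermite_monic n).map _
    change IsUnit (hermiteReal n).leadingCoeff
    rw [this.leadingCoeff]
    exact isUnit_one

theorem hermiteBasis_apply (n : ℕ) : hermiteBasis n = hermiteReal n := by
  simp only [hermiteBasis, Polynomial.Sequence.basis_eq_self]; rfl

theorem integrable_mul_prod_polynomial {k : ℕ} {f : (Fin k → ℝ) → ℝ}
    (hf : MemLp f 2 (gaussMeasure k)) (p : Fin k → Polynomial ℝ) :
    Integrable (fun x => f x * ∏ i, (p i).eval (x i)) (gaussMeasure k) :=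
  hf.integrable_mul (memLp_prod_polynomial_gaussMeasure p)

theorem prod_eval_update {k : ℕ} (p : Fin k → Polynomial ℝ) (i : Fin k) (c : Polynomial ℝ)
    (x : Fin k → ℝ) : ∏ j, (Function.update p i c j).eval (x j) =
      c.eval (x i) * ∏ j ∈ Finset.univ.erase i, (p j).eval (x j) := by
  rw [← Finset.mul_prod_erase _ _ (Finset.mem_univ i), Function.update_self]
  congr 1
  exact Finset.prod_congr rfl fun j hj => by
    rw [Function.update_of_ne (Finset.ne_of_mem_erase hj)]

/-- Integration of `f` against products of univariate polynomials, as a multilinear map. -/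
noncomputable def polynomialPairing {k : ℕ} {f : (Fin k → ℝ) → ℝ}
    (hf : MemLp f 2 (gaussMeasure k)) :
    MultilinearMap ℝ (fun _ : Fin k => Polynomial ℝ) ℝ where
  toFun p := ∫ x, f x * ∏ i, (p i).eval (x i) ∂gaussMeasure k
  map_update_add' {inst} p i a b := by
    -- The structure field quantifies over every decidable equality, whereas `prod_eval_update` uses
    -- the canonical one.
    have e : inst = instDecidableEqFin k := Subsingleton.elim _ _
    subst e
    rw [← integral_add (integrable_mul_prod_polynomial hf _) (integrable_mul_prod_polynomial hf _)]
    congr 1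
    ext x
    simp only [prod_eval_update, Polynomial.eval_add]
    ring
  map_update_smul' {inst} p i c a := by
    have e : inst = instDecidableEqFin k := Subsingleton.elim _ _
    subst e
    rw [smul_eq_mul, ← integral_const_mul]
    congr 1
    ext x
    simp only [prod_eval_update, Polynomial.eval_smul, smul_eq_mul]
    ring

/-- A multilinear map that vanishes on a basis in every argument is zero, and the Hermite
polynomials form a basis of the polynomials. -/
theorem integral_mul_prod_polynomial_eq_zero {k : ℕ} {f : (Fin k → ℝ) → ℝ}
    (hf : MemLp f 2 (gaussMeasure k)) (h0 : ∀ α, hermiteCoeff f α = 0)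
    (p : Fin k → Polynomial ℝ) :
    ∫ x, f x * ∏ i, (p i).eval (x i) ∂gaussMeasure k = 0 := by
  have h : polynomialPairing hf = 0 := by
    refine Module.Basis.ext_multilinear (fun _ => hermiteBasis) fun α => ?_
    change ∫ x, f x * ∏ i, (hermiteBasis (α i)).eval (x i) ∂gaussMeasure k = 0
    have h1 := h0 α
    simp only [hermiteCoeff, hermiteFun_eq_prod, mul_left_comm _ (∏ i, √((α i)! : ℝ))⁻¹] at h1
    rw [integral_const_mul] at h1
    have h2 : (∏ i, √((α i)! : ℝ))⁻¹ ≠ 0 :=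
      inv_ne_zero (Finset.prod_ne_zero_iff.2 fun i _ => by positivity)
    simpa only [hermiteBasis_apply] using (mul_eq_zero.1 h1).resolve_left h2
  exact congrArg (fun M => M p) h

theorem integral_mul_sum_pow_eq_zero {k : ℕ} {f : (Fin k → ℝ) → ℝ}
    (hf : MemLp f 2 (gaussMeasure k)) (h0 : ∀ α, hermiteCoeff f α = 0) (c : Fin k → ℝ) (n : ℕ) :
    ∫ x, f x * (∑ i, c i * x i) ^ n ∂gaussMeasure k = 0 := by
  have h : ∀ x : Fin k → ℝ, f x * (∑ i, c i * x i) ^ n =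
      ∑ a ∈ Finset.univ.piAntidiag n, (Nat.multinomial Finset.univ a : ℝ) *
        (f x * ∏ i, ((Polynomial.C (c i) * Polynomial.X) ^ a i).eval (x i)) := by
    intro x
    rw [Finset.sum_pow_eq_sum_piAntidiag, Finset.mul_sum]
    refine Finset.sum_congr rfl fun a _ => ?_
    simp
    ring
  simp only [h]
  rw [integral_finsetSum _ fun a _ => (integrable_mul_prod_polynomial hf _).const_mul _]
  refine Finset.sum_eq_zero fun a _ => ?_
  rw [integral_const_mul, integral_mul_prod_polynomial_eq_zero hf h0, mul_zero]

theorem integrable_exp_sum_gaussMeasure {k : ℕ} (c : Fin k → ℝ) :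
    Integrable (fun x : Fin k → ℝ => Real.exp (∑ i, c i * x i)) (gaussMeasure k) := by
  simp only [Real.exp_sum]
  exact Integrable.fintype_prod (f := fun i (y : ℝ) => Real.exp (c i * y))
    fun i => integrable_exp_mul_gaussianReal (c i)

/-- exp(2|t|) ≤ exp(2t) + exp(-2t). This provides the dominating function when the characteristic
function is expanded into moments. -/
theorem memLp_exp_abs_sum_gaussMeasure {k : ℕ} (c : Fin k → ℝ) :
    MemLp (fun x : Fin k → ℝ => Real.exp |∑ i, c i * x i|) 2 (gaussMeasure k) := by
  have hc : Continuous fun x : Fin k → ℝ => Real.exp |∑ i, c i * x i| := by fun_prop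
  rw [memLp_two_iff_integrable_sq hc.aestronglyMeasurable]
  have h := (integrable_exp_sum_gaussMeasure fun i => 2 * c i).add
    (integrable_exp_sum_gaussMeasure fun i => -(2 * c i))
  refine h.mono' (hc.pow 2).aestronglyMeasurable (ae_of_all _ fun x => ?_)
  have e1 : ∑ i, 2 * c i * x i = 2 * ∑ i, c i * x i := by
    rw [Finset.mul_sum]; exact Finset.sum_congr rfl fun _ _ => by ring
  have e2 : ∑ i, -(2 * c i) * x i = -(2 * ∑ i, c i * x i) := by
    rw [Finset.mul_sum, ← Finset.sum_neg_distrib]; exact Finset.sum_congr rfl fun _ _ => by ring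
  rw [Pi.add_apply, e1, e2, Real.norm_of_nonneg (by positivity), ← Real.exp_nat_mul]
  rcases abs_cases (∑ i, c i * x i) with ⟨h, -⟩ | ⟨h, -⟩ <;> rw [h] <;> push_cast
  · have := Real.exp_pos (-(2 * ∑ i, c i * x i)); linarith
  · have := Real.exp_pos (2 * ∑ i, c i * x i)
    rw [mul_neg]; linarith

/-- The exponential series is integrated term by term; |f| exp|s| dominates it and is integrable as
a product of two L² functions. Each term is a polynomial moment of f, hence zero. -/
theorem integral_mul_cexp_sum_eq_zero {k : ℕ} {f : (Fin k → ℝ) → ℝ}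
    (hf : MemLp f 2 (gaussMeasure k)) (h0 : ∀ α, hermiteCoeff f α = 0) (c : Fin k → ℝ) :
    ∫ x, (f x : ℂ) * Complex.exp (((∑ i, c i * x i : ℝ) : ℂ) * Complex.I) ∂gaussMeasure k = 0 := by
  set s : (Fin k → ℝ) → ℝ := fun x => ∑ i, c i * x i with hs
  have hsc : Continuous s := by fun_prop
  have hexp : ∀ x, HasSum (fun n : ℕ => |f x| * (|s x| ^ n / n !)) (|f x| * Real.exp |s x|) := by
    intro x
    refine HasSum.mul_left _ ?_
    rw [Real.exp_eq_exp_ℝ]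
    exact NormedSpace.expSeries_div_hasSum_exp _
  have h := hasSum_integral_of_dominated_convergence (μ := gaussMeasure k)
    (F := fun (n : ℕ) x => (f x : ℂ) * (((s x : ℂ) * Complex.I) ^ n / n !))
    (f := fun x => (f x : ℂ) * Complex.exp ((s x : ℂ) * Complex.I))
    (fun n x => |f x| * (|s x| ^ n / n !))
    (fun n => (Complex.continuous_ofReal.comp_aestronglyMeasurable hf.1).mul
      (Continuous.aestronglyMeasurable (by fun_prop)))
    (fun n => ae_of_all _ fun x => by simp)
    (ae_of_all _ fun x => (hexp x).summable)
    (by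
      simp only [fun x => (hexp x).tsum_eq]
      exact hf.abs.integrable_mul (memLp_exp_abs_sum_gaussMeasure c))
    (ae_of_all _ fun x => by
      refine HasSum.mul_left _ ?_
      rw [Complex.exp_eq_exp_ℂ]
      exact NormedSpace.expSeries_div_hasSum_exp _)
  have hz : ∀ n : ℕ, ∫ x, (f x : ℂ) * (((s x : ℂ) * Complex.I) ^ n / n !) ∂gaussMeasure k = 0 := by
    intro n
    have e : ∀ x, (f x : ℂ) * (((s x : ℂ) * Complex.I) ^ n / n !) =
        (Complex.I ^ n / n !) * ((f x * s x ^ n : ℝ) : ℂ) := by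
      intro x; push_cast; ring
    simp only [e]
    rw [integral_const_mul, integral_complex_ofReal, integral_mul_sum_pow_eq_zero hf h0]
    simp
  simp only [hz] at h
  exact (h.unique hasSum_zero)

/-- The positive and negative parts of f are densities of two finite measures with equal
characteristic functions. The measures therefore coincide, and so do the parts. -/
theorem ae_eq_zero_of_hermiteCoeff_eq_zero {k : ℕ} {f : (Fin k → ℝ) → ℝ}
    (hm : Measurable f) (hf : MemLp f 2 (gaussMeasure k)) (h0 : ∀ α, hermiteCoeff f α = 0) :
    f =ᵐ[gaussMeasure k] 0 := by
  have hi : Integrable f (gaussMeasure k) := hf.integrable (by norm_num)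
  have : IsFiniteMeasure ((gaussMeasure k).withDensity fun x => ENNReal.ofReal (f x)) :=
    isFiniteMeasure_withDensity_ofReal hi.2
  have : IsFiniteMeasure ((gaussMeasure k).withDensity fun x => ENNReal.ofReal (-f x)) :=
    isFiniteMeasure_withDensity_ofReal hi.neg.2
  have h : ((gaussMeasure k).withDensity fun x => ENNReal.ofReal (f x)) =
      (gaussMeasure k).withDensity fun x => ENNReal.ofReal (-f x) := by
    apply Measure.ext_of_charFunDual
    ext L
    rw [charFunDual_apply, charFunDual_apply,
      integral_withDensity_eq_integral_toReal_smul (by fun_prop) (ae_of_all _ fun _ => by simp),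
      integral_withDensity_eq_integral_toReal_smul (by fun_prop) (ae_of_all _ fun _ => by simp),
      ← sub_eq_zero]
    have hL : ∀ x : Fin k → ℝ, L x = ∑ i, L (Pi.single i 1) * x i := by
      intro x
      conv_lhs => rw [← Finset.univ_sum_single x, map_sum]
      refine Finset.sum_congr rfl fun i _ => ?_
      have : (Pi.single i (x i) : Fin k → ℝ) = x i • Pi.single i 1 := by simp [← Pi.single_smul]
      rw [this, map_smul, smul_eq_mul, mul_comm]
    have hb : ∀ g : (Fin k → ℝ) → ℝ, Integrable g (gaussMeasure k) → Integrable
        (fun x => g x • Complex.exp ((L x : ℂ) * Complex.I)) (gaussMeasure k) := by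
      intro g hg
      refine (hg.norm).mono (hg.1.smul (Continuous.aestronglyMeasurable (by fun_prop)))
        (ae_of_all _ fun x => ?_)
      rw [norm_smul, Complex.norm_exp_ofReal_mul_I]
      simp
    have e : ∀ x, (ENNReal.ofReal x).toReal = max x 0 := fun x => ENNReal.toReal_ofReal' 
    simp only [e]
    rw [← integral_sub (hb _ hi.pos_part) (hb _ hi.neg_part),
      ← integral_mul_cexp_sum_eq_zero hf h0 fun i => L (Pi.single i 1)]
    refine integral_congr_ae (ae_of_all _ fun x => ?_)
    have hx : max (f x) 0 - max (-f x) 0 = f x := max_zero_sub_max_neg_zero_eq_self _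
    simp only [← hL, Complex.real_smul]
    rw [← sub_mul, ← Complex.ofReal_sub, hx]
  rw [withDensity_eq_iff (by fun_prop) (by fun_prop) hi.lintegral_lt_top.ne] at h
  filter_upwards [h] with x hx
  rcases le_total (f x) 0 with h1 | h1
  · rw [ENNReal.ofReal_of_nonpos h1] at hx
    have := ENNReal.ofReal_eq_zero.1 hx.symm
    simp; linarith
  · rw [ENNReal.ofReal_of_nonpos (p := -f x) (by linarith)] at hx
    have := ENNReal.ofReal_eq_zero.1 hx
    simp; linarith

/-- The Hermite polynomials as elements of `L²(γ_k)`. -/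
noncomputable def hermiteLp {k : ℕ} (α : Fin k → ℕ) : Lp ℝ 2 (gaussMeasure k) :=
  (memLp_hermiteFun α).toLp

theorem inner_toLp_toLp {α : Type*} [MeasurableSpace α] {μ : Measure α} {f g : α → ℝ}
    (hf : MemLp f 2 μ) (hg : MemLp g 2 μ) :
    inner ℝ (hf.toLp) (hg.toLp) = ∫ x, f x * g x ∂μ := by
  rw [L2.inner_def]
  refine integral_congr_ae ?_
  filter_upwards [hf.coeFn_toLp, hg.coeFn_toLp] with x h1 h2
  simp [h1, h2, mul_comm]

theorem inner_hermiteLp_toLp {k : ℕ} {f : (Fin k → ℝ) → ℝ} (hf : MemLp f 2 (gaussMeasure k))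
    (α : Fin k → ℕ) : inner ℝ (hermiteLp α) hf.toLp = hermiteCoeff f α := by
  rw [hermiteLp, inner_toLp_toLp, hermiteCoeff]
  simp only [mul_comm]

theorem orthonormal_hermiteLp (k : ℕ) : Orthonormal ℝ (hermiteLp (k := k)) := by
  rw [orthonormal_iff_ite]
  intro α β
  rw [hermiteLp, hermiteLp, inner_toLp_toLp, integral_hermiteFun_mul_hermiteFun]

theorem span_hermiteLp_orthogonal (k : ℕ) :
    (Submodule.span ℝ (range (hermiteLp (k := k))))ᗮ = ⊥ := by
  rw [Submodule.eq_bot_iff]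
  intro f hf
  rw [Submodule.mem_orthogonal] at hf
  have hmem := Lp.memLp f
  have h0 : ∀ α, hermiteCoeff f α = 0 := by
    intro α
    rw [← inner_hermiteLp_toLp hmem, Lp.toLp_coeFn]
    exact hf _ (Submodule.subset_span (mem_range_self α))
  rw [Lp.eq_zero_iff_ae_eq_zero]
  exact ae_eq_zero_of_hermiteCoeff_eq_zero (Lp.stronglyMeasurable f).measurable hmem h0

/-- The Hilbert basis of `L²(γ_k)` that consists of the Hermite polynomials. -/
noncomputable def hermiteHilbertBasis (k : ℕ) :
    HilbertBasis (Fin k → ℕ) ℝ (Lp ℝ 2 (gaussMeasure k)) :=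
  HilbertBasis.mkOfOrthogonalEqBot (orthonormal_hermiteLp k) (span_hermiteLp_orthogonal k)

theorem hasSum_hermiteCoeff_smul_hermiteLp {k : ℕ} {f : (Fin k → ℝ) → ℝ}
    (hf : MemLp f 2 (gaussMeasure k)) :
    HasSum (fun α => hermiteCoeff f α • hermiteLp α) hf.toLp := by
  have h := (hermiteHilbertBasis k).hasSum_repr hf.toLp
  simpa only [HilbertBasis.repr_apply_apply, hermiteHilbertBasis,
    HilbertBasis.coe_mkOfOrthogonalEqBot, inner_hermiteLp_toLp] using h

/-- The correlation of `f` evaluated at two correlated Gaussian vectors. -/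
theorem hasSum_hermiteCoeff_sq_mul_pow {ι : Type*} [Fintype ι] {k : ℕ} {f : (Fin k → ℝ) → ℝ}
    (hf : MemLp f 2 (gaussMeasure k)) {w w' : ι → ℝ} {r : ℝ}
    (hw : ∑ l, w l ^ 2 = 1) (hw' : ∑ l, w' l ^ 2 = 1) (hr : ∑ l, w l * w' l = r) :
    HasSum (fun α => hermiteCoeff f α * hermiteCoeff f α * r ^ ∑ i, α i)
      (∫ g, f (gaussProj k w g) * f (gaussProj k w' g) ∂gaussArray k ι) := by
  have m := measurePreserving_gaussProj k hw
  have m' := measurePreserving_gaussProj k hw'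
  set T := Lp.compMeasurePreservingₗᵢ (E := ℝ) (p := 2) ℝ _ m with hT
  set T' := Lp.compMeasurePreservingₗᵢ (E := ℝ) (p := 2) ℝ _ m' with hT'
  have hTl : ∀ {u : (Fin k → ℝ) → ℝ} (hu : MemLp u 2 (gaussMeasure k)),
      T hu.toLp = (hu.comp_measurePreserving m).toLp := fun hu => Lp.toLp_compMeasurePreserving hu m
  have hTl' : ∀ {u : (Fin k → ℝ) → ℝ} (hu : MemLp u 2 (gaussMeasure k)),
      T' hu.toLp = (hu.comp_measurePreserving m').toLp :=
    fun hu => Lp.toLp_compMeasurePreserving hu m'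
  have hs := hasSum_hermiteCoeff_smul_hermiteLp hf
  -- T and T' compose a function with the two correlated Gaussian vectors. Only the diagonal term of
  -- the expansion survives the pairing.
  have h1 : ∀ α, inner ℝ (T' hf.toLp) (T (hermiteLp α)) = hermiteCoeff f α * r ^ ∑ i, α i := by
    intro α
    have h2 := (hs.mapL T'.toContinuousLinearMap).mapL (innerSL ℝ (T (hermiteLp α)))
    have h3 : ∀ β, inner ℝ (T (hermiteLp α)) (T' (hermiteLp β)) =
        if α = β then r ^ ∑ i, α i else 0 := by
      intro β
      rw [hermiteLp, hermiteLp, hTl, hTl', inner_toLp_toLp]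
      exact integral_hermiteFun_gaussProj hw hw' hr α β
    simp only [LinearIsometry.coe_toContinuousLinearMap, map_smul, innerSL_apply_apply,
      smul_eq_mul, h3] at h2
    rw [real_inner_comm]
    refine h2.unique ?_
    have e : (fun β => hermiteCoeff f β * if α = β then r ^ ∑ i, α i else 0) =
        fun β => if β = α then hermiteCoeff f α * r ^ ∑ i, α i else 0 := by
      ext β
      by_cases hβ : β = α
      · simp [hβ]
      · rw [if_neg hβ, if_neg (Ne.symm hβ), mul_zero]
    rw [e]
    exact hasSum_ite_eq α _
  have h2 := (hs.mapL T.toContinuousLinearMap).mapL (innerSL ℝ (T' hf.toLp))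
  simp only [LinearIsometry.coe_toContinuousLinearMap, map_smul, innerSL_apply_apply,
    smul_eq_mul, h1] at h2
  rw [hTl, hTl', inner_toLp_toLp] at h2
  simpa only [mul_assoc, Function.comp_apply, mul_comm (f (gaussProj k w' _))] using h2

/-- The multi-indices are grouped by total degree; every group is finite, so its sum is a single
coefficient of h. -/
theorem hasSum_corrCoeff_mul_pow {k : ℕ} {f : (Fin k → ℝ) → ℝ} {r a : ℝ}
    (h : HasSum (fun α => hermiteCoeff f α * hermiteCoeff f α * r ^ ∑ i, α i) a) :
    HasSum (fun ν => corrCoeff f f ν * r ^ ν) a := by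
  rw [← (Equiv.sigmaFiberEquiv fun α : Fin k → ℕ => ∑ i, α i).hasSum_iff] at h
  refine h.sigma fun ν => ?_
  have hset : {α : Fin k → ℕ | ∑ i, α i = ν} =
      (↑(Finset.piAntidiag (Finset.univ : Finset (Fin k)) ν) : Set (Fin k → ℕ)) := by
    ext α; simp
  have e : corrCoeff f f ν * r ^ ν = ∑ α ∈ Finset.piAntidiag (Finset.univ : Finset (Fin k)) ν,
      hermiteCoeff f α * hermiteCoeff f α * r ^ ∑ i, α i := by
    rw [corrCoeff, Finset.sum_mul]
    refine Finset.sum_congr rfl fun α hα => ?_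
    rw [(Finset.mem_piAntidiag.1 hα).1]
  rw [e]
  have h2 := Finset.hasSum (Finset.piAntidiag (Finset.univ : Finset (Fin k)) ν)
    fun α => hermiteCoeff f α * hermiteCoeff f α * r ^ ∑ i, α i
  have h3 := (hasSum_subtype_iff_indicator (s := {α : Fin k → ℕ | ∑ i, α i = ν})
    (f := fun α => hermiteCoeff f α * hermiteCoeff f α * r ^ ∑ i, α i)).2 (by
      rw [hset]; exact hasSum_subtype_iff_indicator.1 h2)
  exact h3

theorem integral_gaussProj_mul_gaussProj {ι : Type*} [Fintype ι] {k : ℕ} {f : (Fin k → ℝ) → ℝ}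
    (hf : MemLp f 2 (gaussMeasure k)) {w w' : ι → ℝ}
    (hw : ∑ l, w l ^ 2 = 1) (hw' : ∑ l, w' l ^ 2 = 1) :
    ∫ g, f (gaussProj k w g) * f (gaussProj k w' g) ∂gaussArray k ι =
      corrFun f f (∑ l, w l * w' l) :=
  (hasSum_corrCoeff_mul_pow (hasSum_hermiteCoeff_sq_mul_pow hf hw hw' rfl)).tsum_eq.symm

theorem hasSum_corrCoeff {k : ℕ} {f : (Fin k → ℝ) → ℝ} (hf : MemLp f 2 (gaussMeasure k)) :
    HasSum (corrCoeff f f) (∫ x, f x ^ 2 ∂gaussMeasure k) := by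
  -- With a one-point index set and weight 1 the two Gaussian vectors coincide, and the correlation
  -- identity at r = 1 becomes Parseval's identity.
  have hw : ∑ _l : Unit, (1 : ℝ) ^ 2 = 1 := by simp
  have h := hasSum_corrCoeff_mul_pow
    (hasSum_hermiteCoeff_sq_mul_pow (ι := Unit) (w := fun _ => 1) (w' := fun _ => 1) (r := 1)
      hf hw hw (by simp))
  simp only [one_pow, mul_one] at h
  convert h using 1
  have m := measurePreserving_gaussProj (ι := Unit) k hw
  rw [← m.map_eq, integral_map m.aemeasurable]
  · simp only [sq]
  · rw [m.map_eq]; exact hf.1.pow 2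

/-! ### The coefficients of the correlation function -/

theorem corrCoeff_nonneg {k : ℕ} (f : (Fin k → ℝ) → ℝ) (ν : ℕ) : 0 ≤ corrCoeff f f ν :=
  Finset.sum_nonneg fun _ _ => mul_self_nonneg _

theorem memLp_two_of_memLp_top {k : ℕ} {f : (Fin k → ℝ) → ℝ} (hf : MemLp f ∞ (gaussMeasure k)) :
    MemLp f 2 (gaussMeasure k) :=
  hf.mono_exponent le_top

theorem integral_sq_eq_one {k : ℕ} {f : (Fin k → ℝ) → ℝ} (hf : MemLp f ∞ (gaussMeasure k))
    (h2 : eLpNorm f 2 (gaussMeasure k) = 1) : ∫ x, f x ^ 2 ∂gaussMeasure k = 1 := by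
  have h := memLp_two_of_memLp_top hf
  have e := h.eLpNorm_eq_integral_rpow_norm (by simp) (by simp)
  rw [h2] at e
  have e2 := congrArg ENNReal.toReal e
  have h0 : 0 ≤ ∫ x, f x ^ 2 ∂gaussMeasure k := integral_nonneg fun x => sq_nonneg _
  simp only [ENNReal.toReal_one, ENNReal.toReal_ofNat, Real.rpow_ofNat, Real.norm_eq_abs,
    sq_abs] at e2
  rw [ENNReal.toReal_ofReal (by positivity), ← one_div, ← Real.sqrt_eq_rpow] at e2
  have := (Real.sqrt_eq_one).1 e2.symm
  exact this

theorem one_le_linftyNorm {k : ℕ} {f : (Fin k → ℝ) → ℝ} (hf : MemLp f ∞ (gaussMeasure k))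
    (h2 : eLpNorm f 2 (gaussMeasure k) = 1) : 1 ≤ linftyNorm f := by
  have h := eLpNorm_le_eLpNorm_of_exponent_le (μ := gaussMeasure k) (p := 2) (q := ∞) le_top hf.1
  rw [h2] at h
  have := ENNReal.toReal_mono hf.2.ne h
  simpa [linftyNorm] using this

theorem ae_abs_le_linftyNorm {k : ℕ} {f : (Fin k → ℝ) → ℝ} (hf : MemLp f ∞ (gaussMeasure k)) :
    ∀ᵐ x ∂gaussMeasure k, |f x| ≤ linftyNorm f := by
  filter_upwards [ae_le_eLpNormEssSup (f := f) (μ := gaussMeasure k)] with x hx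
  rw [← eLpNorm_exponent_top] at hx
  have := ENNReal.toReal_mono hf.2.ne hx
  simpa [linftyNorm] using this

theorem measurePreserving_neg_gaussMeasure (k : ℕ) :
    MeasurePreserving (fun x : Fin k → ℝ => -x) (gaussMeasure k) (gaussMeasure k) :=
  measurePreserving_pi _ _ fun _ => ⟨measurable_neg, by
    have := gaussianReal_map_neg (μ := 0) (v := 1)
    rw [neg_zero] at this
    exact this⟩

theorem hermiteFun_neg {k : ℕ} (α : Fin k → ℕ) (x : Fin k → ℝ) :
    hermiteFun α (-x) = (-1) ^ (∑ i, α i) * hermiteFun α x := by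
  simp only [hermiteFun_eq_prod, Pi.neg_apply, eval_neg_hermiteReal, Finset.prod_mul_distrib,
    Finset.prod_pow_eq_pow_sum]
  ring

/-- The Gaussian measure is invariant under reflection, so an even Hermite polynomial is orthogonal
to an odd function. -/
theorem corrCoeff_eq_zero_of_even {k : ℕ} {f : (Fin k → ℝ) → ℝ} (ho : IsOddAE f) {ν : ℕ}
    (hν : Even ν) : corrCoeff f f ν = 0 := by
  refine Finset.sum_eq_zero fun α hα => ?_
  have hs : ∑ i, α i = ν := (Finset.mem_piAntidiag.1 hα).1
  have h : hermiteCoeff f α = -hermiteCoeff f α := by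
    conv_lhs => rw [hermiteCoeff, ← (measurePreserving_neg_gaussMeasure k).integral_comp
      (MeasurableEquiv.neg (Fin k → ℝ)).measurableEmbedding]
    rw [hermiteCoeff, ← integral_neg]
    refine integral_congr_ae ?_
    filter_upwards [ho] with x hx
    rw [hx, hermiteFun_neg, hs, hν.neg_one_pow]
    ring
  have : hermiteCoeff f α = 0 := by linarith
  rw [this, mul_zero]

theorem piAntidiag_univ_one (k : ℕ) : Finset.piAntidiag (Finset.univ : Finset (Fin k)) 1 =
    Finset.univ.image fun i => Pi.single i 1 := by
  ext α
  simp only [Finset.mem_piAntidiag, Finset.mem_univ, implies_true, and_true, Finset.mem_image,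
    true_and]
  constructor
  · intro h
    obtain ⟨i, hi⟩ : ∃ i, α i ≠ 0 := by
      by_contra! h0
      simp [h0] at h
    refine ⟨i, ?_⟩
    rw [← Finset.add_sum_erase _ _ (Finset.mem_univ i)] at h
    have h1 : ∑ j ∈ Finset.univ.erase i, α j = 0 := by omega
    ext j
    by_cases hj : j = i
    · subst hj; simp; omega
    · rw [Pi.single_eq_of_ne hj]
      exact (Finset.sum_eq_zero_iff.1 h1 j (by simp [hj])).symm
  · rintro ⟨i, rfl⟩
    simp

theorem hermiteFun_single {k : ℕ} (i : Fin k) (x : Fin k → ℝ) :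
    hermiteFun (Pi.single i 1) x = x i := by
  rw [hermiteFun, Finset.prod_eq_single i]
  · simp
  · intro j _ hj
    simp [Pi.single_eq_of_ne hj]
  · simp

theorem corrCoeff_one {k : ℕ} (f : (Fin k → ℝ) → ℝ) :
    corrCoeff f f 1 = ∑ i, (∫ x, f x * x i ∂gaussMeasure k) ^ 2 := by
  rw [corrCoeff, piAntidiag_univ_one, Finset.sum_image]
  · simp only [hermiteCoeff, hermiteFun_single, sq]
  · intro i _ j _ h
    by_contra hij
    have := congrFun h i
    simp [Pi.single_eq_of_ne hij] at this

/-! ### Bounds on the first-order coefficient. -/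

theorem integral_abs_stdGauss : ∫ y, |y| ∂stdGauss = 2 * gaussianPDFReal 0 1 0 := by
  rw [stdGauss, integral_gaussianReal_eq_integral_smul one_ne_zero]
  have h := integral_Ioi_gaussianPDFReal_mul_hermiteReal_succ 0
  simp only [zero_add, hermiteReal_one, hermiteReal_zero, Polynomial.eval_X,
    Polynomial.eval_one, mul_one] at h
  rw [← h, ← integral_comp_abs (f := fun y => gaussianPDFReal 0 1 y * y)]
  congr 1
  ext y
  simp [gaussianPDFReal]

theorem two_mul_gaussianPDFReal_zero_sq : (2 * gaussianPDFReal 0 1 0) ^ 2 = 2 / Real.pi := by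
  simp only [gaussianPDFReal, NNReal.coe_one, mul_one, sub_self, ne_eq, OfNat.ofNat_ne_zero,
    not_false_eq_true, zero_pow, neg_zero, zero_div, Real.exp_zero]
  rw [mul_pow, inv_pow, Real.sq_sqrt (by positivity)]
  field_simp

theorem integrable_id_stdGauss : Integrable (fun y : ℝ => y) stdGauss := by
  simpa using integrable_polynomial_stdGauss Polynomial.X

/-- The normalised first-order Hermite projection. -/
theorem exists_unit_integral_mul_eq_sqrt_corrCoeff_one {k : ℕ} {f : (Fin k → ℝ) → ℝ}
    (hf : MemLp f 2 (gaussMeasure k)) (h : corrCoeff f f 1 ≠ 0) :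
    ∃ w : Fin k → ℝ, ∑ i, w i ^ 2 = 1 ∧
      ∫ x, f x * (∑ i, w i * x i) ∂gaussMeasure k = √(corrCoeff f f 1) := by
  have hp : 0 < corrCoeff f f 1 := lt_of_le_of_ne (corrCoeff_nonneg f 1) h.symm
  have h1 := corrCoeff_one f
  set p := corrCoeff f f 1
  -- The direction is the vector of degree-one coefficients of f, whose Euclidean norm is √p.
  refine ⟨fun i => (√p)⁻¹ * ∫ x, f x * x i ∂gaussMeasure k, ?_, ?_⟩
  · simp only [mul_pow]
    rw [← Finset.mul_sum, ← h1, inv_pow, Real.sq_sqrt hp.le, inv_mul_cancel₀ h]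
  · have hi : ∀ i, Integrable (fun x => f x * x i) (gaussMeasure k) := by
      intro i
      have := hf.integrable_mul (memLp_hermiteFun (Pi.single i 1))
      refine this.congr (ae_of_all _ fun x => ?_)
      simp [hermiteFun_single]
    have e : ∀ x : Fin k → ℝ,
        f x * (∑ i, ((√p)⁻¹ * ∫ x, f x * x i ∂gaussMeasure k) * x i) =
        ∑ i, ((√p)⁻¹ * ∫ x, f x * x i ∂gaussMeasure k) * (f x * x i) := by
      intro x
      rw [Finset.mul_sum]
      exact Finset.sum_congr rfl fun _ _ => by ring
    simp only [e]
    rw [integral_finsetSum _ fun i _ => (hi i).const_mul _]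
    simp only [integral_const_mul, mul_assoc, ← sq]
    rw [← Finset.mul_sum, ← h1]
    have : √p ≠ 0 := (Real.sqrt_pos.2 hp).ne'
    field_simp
    exact (Real.sq_sqrt hp.le).symm

/-- √p_1 is the pairing of f with a standard Gaussian linear functional, hence at most ‖f‖_∞ times
its absolute mean √(2/π). -/
theorem corrCoeff_one_le {k : ℕ} {f : (Fin k → ℝ) → ℝ} (hf : MemLp f ∞ (gaussMeasure k)) :
    corrCoeff f f 1 ≤ 2 / Real.pi * linftyNorm f ^ 2 := by
  by_cases h : corrCoeff f f 1 = 0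
  · rw [h]; positivity
  obtain ⟨w, hw, hI⟩ := exists_unit_integral_mul_eq_sqrt_corrCoeff_one (memLp_two_of_memLp_top hf) h
  have m := measurePreserving_dotProduct_stdGaussPi hw
  have hia : Integrable (fun x : Fin k → ℝ => |∑ i, w i * x i|) (gaussMeasure k) :=
    (m.integrable_comp_of_integrable integrable_id_stdGauss).abs
  have h1 : √(corrCoeff f f 1) ≤ linftyNorm f * (2 * gaussianPDFReal 0 1 0) := by
    rw [← hI, ← integral_abs_stdGauss, ← m.map_eq,
      integral_map m.aemeasurable continuous_abs.aestronglyMeasurable, ← integral_const_mul]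
    refine (Real.le_norm_self _).trans ((norm_integral_le_integral_norm _).trans ?_)
    refine integral_mono_of_nonneg (ae_of_all _ fun x => norm_nonneg _) (hia.const_mul _) ?_
    filter_upwards [ae_abs_le_linftyNorm hf] with x hx
    rw [norm_mul, Real.norm_eq_abs, Real.norm_eq_abs]
    exact mul_le_mul_of_nonneg_right hx (abs_nonneg _)
  calc corrCoeff f f 1 = √(corrCoeff f f 1) ^ 2 := (Real.sq_sqrt (corrCoeff_nonneg f 1)).symm
    _ ≤ (linftyNorm f * (2 * gaussianPDFReal 0 1 0)) ^ 2 :=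
        pow_le_pow_left₀ (Real.sqrt_nonneg _) h1 2
    _ = 2 / Real.pi * linftyNorm f ^ 2 := by
        rw [mul_pow, two_mul_gaussianPDFReal_zero_sq, mul_comm]

theorem hasSum_corrCoeff_one {k : ℕ} {f : (Fin k → ℝ) → ℝ} (hf : MemLp f ∞ (gaussMeasure k))
    (h2 : eLpNorm f 2 (gaussMeasure k) = 1) : HasSum (corrCoeff f f) 1 := by
  have h := hasSum_corrCoeff (memLp_two_of_memLp_top hf)
  rwa [integral_sq_eq_one hf h2] at h

theorem not_ae_abs_le_stdGauss (M : ℝ) : ¬ ∀ᵐ y ∂stdGauss, |y| ≤ M := by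
  intro h
  have h1 : ∀ᵐ y : ℝ, |y| ≤ M :=
    (gaussianReal_absolutelyContinuous' 0 one_ne_zero).ae_le h
  have h2 : volume {y : ℝ | ¬ |y| ≤ M} = 0 := h1
  have h3 : Ioi M ⊆ {y : ℝ | ¬ |y| ≤ M} := fun y hy => not_le.2 (lt_of_lt_of_le hy (le_abs_self y))
  have h4 := measure_mono_null h3 h2
  simp at h4

/-- If p_1 = 1, then f has L² distance zero from a unit-variance linear functional. Such a
functional is unbounded, whereas f is essentially bounded. -/
theorem corrCoeff_one_lt_one {k : ℕ} {f : (Fin k → ℝ) → ℝ} (hf : MemLp f ∞ (gaussMeasure k))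
    (h2 : eLpNorm f 2 (gaussMeasure k) = 1) : corrCoeff f f 1 < 1 := by
  have hle : corrCoeff f f 1 ≤ 1 :=
    le_hasSum (hasSum_corrCoeff_one hf h2) 1 fun _ _ => corrCoeff_nonneg f _
  refine lt_of_le_of_ne hle fun h1 => ?_
  have hf2 := memLp_two_of_memLp_top hf
  obtain ⟨w, hw, hI⟩ := exists_unit_integral_mul_eq_sqrt_corrCoeff_one hf2 (by rw [h1]; simp)
  rw [h1, Real.sqrt_one] at hI
  have m := measurePreserving_dotProduct_stdGaussPi hw
  have hL : MemLp (fun x : Fin k → ℝ => ∑ i, w i * x i) 2 (gaussMeasure k) := by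
    have := memLp_polynomial_stdGauss Polynomial.X 2 (by simp)
    simp only [Polynomial.eval_X] at this
    exact this.comp_measurePreserving m
  have hLL : ∫ x : Fin k → ℝ, (∑ i, w i * x i) ^ 2 ∂gaussMeasure k = 1 := by
    have := integral_hermiteReal_dotProduct hw hw (r := 1) (by simpa only [sq] using hw) 1 1
    simp only [hermiteReal_one, Polynomial.eval_X, ← sq, if_true, Nat.factorial_one, Nat.cast_one,
      one_pow] at this
    exact this
  have hz : ∫ x : Fin k → ℝ, (f x - ∑ i, w i * x i) ^ 2 ∂gaussMeasure k = 0 := by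
    have e : ∀ x : Fin k → ℝ, (f x - ∑ i, w i * x i) ^ 2 =
        f x ^ 2 - 2 * (f x * ∑ i, w i * x i) + (∑ i, w i * x i) ^ 2 := fun x => by ring
    simp only [e]
    have i1 : Integrable (fun x => f x * ∑ i, w i * x i) (gaussMeasure k) := hf2.integrable_mul hL
    have i2 : Integrable (fun x => f x ^ 2 - 2 * (f x * ∑ i, w i * x i)) (gaussMeasure k) :=
      hf2.integrable_sq.sub (i1.const_mul _)
    rw [integral_add i2 hL.integrable_sq, integral_sub hf2.integrable_sq (i1.const_mul _),
      integral_const_mul, hI, hLL, integral_sq_eq_one hf h2]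
    norm_num
  have hz := (integral_eq_zero_iff_of_nonneg (fun x => sq_nonneg _) (hf2.sub hL).integrable_sq).1 hz
  apply not_ae_abs_le_stdGauss (linftyNorm f)
  rw [← m.map_eq, ae_map_iff m.aemeasurable (measurableSet_le (by fun_prop) (by fun_prop))]
  filter_upwards [hz, ae_abs_le_linftyNorm hf] with x h3 h4
  have : f x = ∑ i, w i * x i := by
    exact sub_eq_zero.1 (pow_eq_zero_iff two_ne_zero |>.1 h3)
  rwa [← this]

/-! ### Absolutely convergent power series on the unit interval -/

section PowerSeries

variable {𝕜 : Type*} [RCLike 𝕜]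

/-- The sum of a power series with scalar coefficients. -/
noncomputable def powerSum (a : ℕ → 𝕜) (x : 𝕜) : 𝕜 := ∑' n, a n * x ^ n

theorem summable_mul_pow {a : ℕ → 𝕜} (ha : Summable fun n => ‖a n‖) {x : 𝕜} (hx : ‖x‖ ≤ 1) :
    Summable fun n => a n * x ^ n := by
  refine Summable.of_norm_bounded ha fun n => ?_
  rw [norm_mul, norm_pow]
  exact mul_le_of_le_one_right (norm_nonneg _) (pow_le_one₀ (norm_nonneg _) hx)

theorem hasSum_powerSum {a : ℕ → 𝕜} (ha : Summable fun n => ‖a n‖) {x : 𝕜} (hx : ‖x‖ ≤ 1) :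
    HasSum (fun n => a n * x ^ n) (powerSum a x) :=
  (summable_mul_pow ha hx).hasSum

theorem continuousOn_powerSum {a : ℕ → 𝕜} (ha : Summable fun n => ‖a n‖) :
    ContinuousOn (powerSum a) {x | ‖x‖ ≤ 1} := by
  refine continuousOn_tsum (fun n => by fun_prop) ha fun n x hx => ?_
  rw [norm_mul, norm_pow]
  exact mul_le_of_le_one_right (norm_nonneg _) (pow_le_one₀ (norm_nonneg _) hx)

theorem hasFPowerSeriesOnBall_powerSum {a : ℕ → 𝕜} (ha : Summable fun n => ‖a n‖) :
    HasFPowerSeriesOnBall (powerSum a) (FormalMultilinearSeries.ofScalars 𝕜 a) 0 1 := by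
  have hr : (1 : ℝ≥0∞) ≤ (FormalMultilinearSeries.ofScalars 𝕜 a).radius := by
    have := (FormalMultilinearSeries.ofScalars 𝕜 a).le_radius_of_summable_norm (r := 1) (by
      simpa [FormalMultilinearSeries.ofScalars_norm] using ha)
    simpa using this
  have h := (FormalMultilinearSeries.ofScalars 𝕜 a).hasFPowerSeriesOnBall
    (lt_of_lt_of_le one_pos hr)
  have e : (FormalMultilinearSeries.ofScalars 𝕜 a).sum = powerSum a := by
    ext x
    simp [FormalMultilinearSeries.sum, powerSum, mul_comm]
  rw [e] at h
  exact h.mono one_pos hr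

theorem analyticOnNhd_powerSum {a : ℕ → 𝕜} (ha : Summable fun n => ‖a n‖) :
    AnalyticOnNhd 𝕜 (powerSum a) (Metric.ball 0 1) := by
  have := (hasFPowerSeriesOnBall_powerSum ha).analyticOnNhd
  rwa [← ENNReal.ofReal_one, Metric.eball_ofReal] at this

theorem iteratedDeriv_powerSum {a : ℕ → 𝕜} (ha : Summable fun n => ‖a n‖) (n : ℕ) :
    iteratedDeriv n (powerSum a) 0 / (n ! : 𝕜) = a n := by
  have h := (hasFPowerSeriesOnBall_powerSum ha).hasFPowerSeriesAt
  have h2 := h.analyticAt.hasFPowerSeriesAt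
  have h3 := congrArg (fun q => q.coeff n) (h.eq_formalMultilinearSeries h2)
  simpa [FormalMultilinearSeries.coeff_ofScalars] using h3.symm

theorem powerSum_zero (a : ℕ → 𝕜) : powerSum a 0 = a 0 := by
  rw [powerSum, tsum_eq_single 0 fun n hn => by simp [hn]]
  simp

theorem powerSum_neg {a : ℕ → 𝕜} (h : ∀ n, Even n → a n = 0) (x : 𝕜) :
    powerSum a (-x) = -powerSum a x := by
  rw [powerSum, powerSum, ← tsum_neg]
  congr 1
  ext n
  rcases Nat.even_or_odd n with hn | hn
  · simp [h n hn]
  · rw [hn.neg_pow]; ring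

end PowerSeries

theorem strictMonoOn_powerSum {a : ℕ → ℝ} (ha : Summable fun n => ‖a n‖) (h0 : ∀ n, 0 ≤ a n)
    (he : ∀ n, Even n → a n = 0) (hp : ∃ n, a n ≠ 0) :
    StrictMonoOn (powerSum a) (Icc (-1) 1) := by
  intro x hx y hy hxy
  obtain ⟨n, hn⟩ := hp
  have hno : Odd n := Nat.not_even_iff_odd.1 fun h => hn (he n h)
  refine hasSum_lt (fun m => ?_) (i := n) ?_ (hasSum_powerSum ha (abs_le.2 hx))
    (hasSum_powerSum ha (abs_le.2 hy))
  · rcases Nat.even_or_odd m with hm | hm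
    · simp [he m hm]
    · exact mul_le_mul_of_nonneg_left (hm.strictMono_pow hxy).le (h0 m)
  · exact mul_lt_mul_of_pos_left (hno.strictMono_pow hxy) (lt_of_le_of_ne (h0 n) hn.symm)

theorem bijOn_powerSum {a : ℕ → ℝ} (ha : Summable fun n => ‖a n‖) (h0 : ∀ n, 0 ≤ a n)
    (he : ∀ n, Even n → a n = 0) (hp : ∃ n, a n ≠ 0) :
    BijOn (powerSum a) (Icc (-1) 1) (Icc (-powerSum a 1) (powerSum a 1)) := by
  have hs := strictMonoOn_powerSum ha h0 he hp
  rw [← powerSum_neg he]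
  have m1 : (-1 : ℝ) ∈ Icc (-1 : ℝ) 1 := by norm_num
  have m2 : (1 : ℝ) ∈ Icc (-1 : ℝ) 1 := by norm_num
  refine ⟨fun x hx => ⟨hs.monotoneOn m1 hx hx.1, hs.monotoneOn hx m2 hx.2⟩, hs.injOn, ?_⟩
  refine intermediate_value_Icc (by norm_num) ((continuousOn_powerSum ha).mono fun x hx => ?_)
  exact abs_le.2 hx

theorem corrFun_eq_powerSum {k : ℕ} (f g : (Fin k → ℝ) → ℝ) :
    corrFun f g = powerSum (corrCoeff f g) := rfl

theorem absSeries_eq_powerSum (ψ : ℝ → ℝ) :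
    absSeries ψ = powerSum fun n => |iteratedDeriv n ψ 0 / (n ! : ℝ)| := by
  ext x
  simp [absSeries, powerSum, abs_div]

theorem complexSeries_eq_powerSum (ψ : ℝ → ℝ) :
    complexSeries ψ = powerSum fun n => ((iteratedDeriv n ψ 0 / (n ! : ℝ) : ℝ) : ℂ) := rfl

/-! ### Inverting odd power series with nonnegative coefficients -/

/-- The coefficient sequence of an odd power series with nonnegative coefficients of sum one. -/
structure IsOddProbSeries (p : ℕ → ℝ) : Prop where
  nonneg : ∀ n, 0 ≤ p n
  hasSum : HasSum p 1
  even : ∀ n, Even n → p n = 0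
  lt_one : p 1 < 1

namespace IsOddProbSeries

variable {p : ℕ → ℝ}

theorem summable_norm (hp : IsOddProbSeries p) : Summable fun n => ‖p n‖ := hp.hasSum.summable.norm

theorem exists_ne_zero (hp : IsOddProbSeries p) : ∃ n, p n ≠ 0 := by
  by_contra! h
  have := hp.hasSum
  simp only [funext h] at this
  exact zero_ne_one (hasSum_zero.unique this)

theorem powerSum_one (hp : IsOddProbSeries p) : powerSum p 1 = 1 := by
  simpa [powerSum] using hp.hasSum.tsum_eq

theorem bijOn (hp : IsOddProbSeries p) : BijOn (powerSum p) (Icc (-1) 1) (Icc (-1) 1) := by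
  simpa only [hp.powerSum_one] using
    bijOn_powerSum hp.summable_norm hp.nonneg hp.even hp.exists_ne_zero

end IsOddProbSeries

/-! ### The inverse of the series on [-1,1]. -/

namespace IsOddProbSeries

variable {p : ℕ → ℝ}

theorem powerSum_invUnit (hp : IsOddProbSeries p) {x : ℝ} (hx : x ∈ Icc (-1 : ℝ) 1) :
    powerSum p (invUnit (powerSum p) x) = x :=
  hp.bijOn.invOn_invFunOn.2 hx

theorem invUnit_powerSum (hp : IsOddProbSeries p) {x : ℝ} (hx : x ∈ Icc (-1 : ℝ) 1) :
    invUnit (powerSum p) (powerSum p x) = x :=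
  hp.bijOn.invOn_invFunOn.1 hx

theorem invUnit_mem (hp : IsOddProbSeries p) {x : ℝ} (hx : x ∈ Icc (-1 : ℝ) 1) :
    invUnit (powerSum p) x ∈ Icc (-1 : ℝ) 1 :=
  hp.bijOn.surjOn.mapsTo_invFunOn hx

theorem invUnit_neg (hp : IsOddProbSeries p) {x : ℝ} (hx : x ∈ Icc (-1 : ℝ) 1) :
    invUnit (powerSum p) (-x) = -invUnit (powerSum p) x := by
  have h := hp.invUnit_mem hx
  have h2 : -invUnit (powerSum p) x ∈ Icc (-1 : ℝ) 1 := ⟨by linarith [h.2], by linarith [h.1]⟩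
  rw [← hp.invUnit_powerSum h2, powerSum_neg hp.even, hp.powerSum_invUnit hx]

theorem invUnit_zero (hp : IsOddProbSeries p) : invUnit (powerSum p) 0 = 0 := by
  have h := hp.invUnit_neg (x := 0) (by norm_num)
  rw [neg_zero] at h
  linarith

end IsOddProbSeries

/-- The Maclaurin coefficients of a function. -/
noncomputable def maclaurinCoeff (ψ : ℝ → ℝ) (n : ℕ) : ℝ := iteratedDeriv n ψ 0 / (n ! : ℝ)

theorem CompletelyRealAnalytic.summable_norm {ψ : ℝ → ℝ} (h : CompletelyRealAnalytic 1 ψ) :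
    Summable fun n => ‖maclaurinCoeff ψ n‖ := by
  simpa only [one_pow, mul_one, maclaurinCoeff, Real.norm_eq_abs] using h.2

/-- Analyticity gives the expansion only near 0; since the series converges on the whole interval,
the identity theorem extends it. -/
theorem CompletelyRealAnalytic.eqOn_powerSum {ψ : ℝ → ℝ} (h : CompletelyRealAnalytic 1 ψ) :
    EqOn ψ (powerSum (maclaurinCoeff ψ)) (Ioo (-1) 1) := by
  have h1 := hasFPowerSeriesOnBall_powerSum h.summable_norm
  have h2 := (h.1 0 (by norm_num)).hasFPowerSeriesAt
  have h3 : AnalyticOnNhd ℝ (powerSum (maclaurinCoeff ψ)) (Ioo (-1) 1) := by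
    have := analyticOnNhd_powerSum h.summable_norm
    rwa [Real.ball_eq_Ioo, zero_sub, zero_add] at this
  refine h.1.eqOn_of_preconnected_of_eventuallyEq h3 isPreconnected_Ioo
    (z₀ := 0) (by norm_num) ?_
  filter_upwards [h1.hasFPowerSeriesAt.eventually_hasSum_sub, h2.eventually_hasSum_sub]
    with x hx1 hx2
  exact hx2.unique hx1

theorem Icc_neg_one_one_mem_nhds_zero : Icc (-1 : ℝ) 1 ∈ nhds (0 : ℝ) :=
  Icc_mem_nhds (by norm_num) (by norm_num)

theorem IsOddProbSeries.maclaurinCoeff_invUnit_even {p : ℕ → ℝ} (hp : IsOddProbSeries p) (n : ℕ)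
    (hn : Even n) : maclaurinCoeff (invUnit (powerSum p)) n = 0 := by
  have h : (fun x => invUnit (powerSum p) (-x)) =ᶠ[nhds 0] -invUnit (powerSum p) := by
    filter_upwards [Icc_neg_one_one_mem_nhds_zero] with x hx
    exact hp.invUnit_neg hx
  have h1 := h.iteratedDeriv_eq n
  rw [iteratedDeriv_comp_neg, iteratedDeriv_neg, hn.neg_one_pow, one_smul, neg_zero] at h1
  rw [maclaurinCoeff]
  have : iteratedDeriv n (invUnit (powerSum p)) 0 = 0 := by linarith
  rw [this, zero_div]

/-- The chain rule at 0 for a function composed with its inverse. In particular p_1 cannot vanish.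
-/
theorem IsOddProbSeries.mul_maclaurinCoeff_one {p : ℕ → ℝ} (hp : IsOddProbSeries p)
    (h : CompletelyRealAnalytic 1 (invUnit (powerSum p))) :
    p 1 * maclaurinCoeff (invUnit (powerSum p)) 1 = 1 := by
  have h1 : HasDerivAt (invUnit (powerSum p)) (maclaurinCoeff (invUnit (powerSum p)) 1) 0 := by
    simpa [maclaurinCoeff] using (h.1 0 (by norm_num)).differentiableAt.hasDerivAt
  have h2 : HasDerivAt (powerSum p) (p 1) (invUnit (powerSum p) 0) := by
    rw [hp.invUnit_zero]
    have := (analyticOnNhd_powerSum hp.summable_norm 0 (by simp)).differentiableAt.hasDerivAt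
    have e := iteratedDeriv_powerSum hp.summable_norm 1
    simp only [iteratedDeriv_one, Nat.factorial_one, Nat.cast_one, div_one] at e
    rwa [e] at this
  have h3 := h2.comp 0 h1
  have h4 : HasDerivAt (powerSum p ∘ invUnit (powerSum p)) 1 0 := by
    refine (hasDerivAt_id (0 : ℝ)).congr_of_eventuallyEq ?_
    filter_upwards [Icc_neg_one_one_mem_nhds_zero] with x hx
    exact hp.powerSum_invUnit hx
  exact h3.unique h4

/-- The coefficients of the absolute inverse series. -/
noncomputable def absInvCoeff (p : ℕ → ℝ) (n : ℕ) : ℝ := |maclaurinCoeff (invUnit (powerSum p)) n|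

theorem absSeries_invUnit_eq (p : ℕ → ℝ) :
    absSeries (invUnit (powerSum p)) = powerSum (absInvCoeff p) :=
  absSeries_eq_powerSum _

/-- The data of an odd power series whose inverse is completely real analytic. -/
structure IsInvertibleSeries (p : ℕ → ℝ) : Prop extends IsOddProbSeries p where
  analytic : CompletelyRealAnalytic 1 (invUnit (powerSum p))

/-! ### The absolute inverse series and the hyperbolic transform. -/

namespace IsInvertibleSeries

variable {p : ℕ → ℝ}

theorem summable_absInvCoeff (hp : IsInvertibleSeries p) : Summable fun n => ‖absInvCoeff p n‖ := by
  simpa [absInvCoeff] using hp.analytic.summable_norm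

theorem absInvCoeff_nonneg (p : ℕ → ℝ) (n : ℕ) : 0 ≤ absInvCoeff p n := abs_nonneg _

theorem absInvCoeff_even (hp : IsInvertibleSeries p) (n : ℕ) (hn : Even n) :
    absInvCoeff p n = 0 := by
  rw [absInvCoeff, hp.maclaurinCoeff_invUnit_even n hn, abs_zero]

theorem coeff_one_pos (hp : IsInvertibleSeries p) : 0 < p 1 := by
  refine lt_of_le_of_ne (hp.nonneg 1) fun h => ?_
  have := hp.mul_maclaurinCoeff_one hp.analytic
  rw [← h, zero_mul] at this
  exact zero_ne_one this

theorem absInvCoeff_one (hp : IsInvertibleSeries p) : absInvCoeff p 1 = (p 1)⁻¹ := by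
  have h := hp.mul_maclaurinCoeff_one hp.analytic
  have h2 : maclaurinCoeff (invUnit (powerSum p)) 1 = (p 1)⁻¹ := eq_inv_of_mul_eq_one_right h
  rw [absInvCoeff, h2, abs_of_pos (inv_pos.2 hp.coeff_one_pos)]

theorem exists_absInvCoeff_ne_zero (hp : IsInvertibleSeries p) : ∃ n, absInvCoeff p n ≠ 0 :=
  ⟨1, by rw [hp.absInvCoeff_one]; exact (inv_pos.2 hp.coeff_one_pos).ne'⟩

theorem strictMonoOn (hp : IsInvertibleSeries p) :
    StrictMonoOn (absSeries (invUnit (powerSum p))) (Icc (-1) 1) := by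
  rw [absSeries_invUnit_eq]
  exact strictMonoOn_powerSum hp.summable_absInvCoeff (absInvCoeff_nonneg p) hp.absInvCoeff_even
    hp.exists_absInvCoeff_ne_zero

theorem bijOn_absSeries (hp : IsInvertibleSeries p) :
    BijOn (absSeries (invUnit (powerSum p))) (Icc (-1) 1)
      (Icc (-absSeries (invUnit (powerSum p)) 1) (absSeries (invUnit (powerSum p)) 1)) := by
  rw [absSeries_invUnit_eq]
  exact bijOn_powerSum hp.summable_absInvCoeff (absInvCoeff_nonneg p) hp.absInvCoeff_even
    hp.exists_absInvCoeff_ne_zero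

theorem absSeries_zero (hp : IsInvertibleSeries p) : absSeries (invUnit (powerSum p)) 0 = 0 := by
  rw [absSeries_invUnit_eq, powerSum_zero, hp.absInvCoeff_even 0 (by simp)]

theorem hasSum_absSeries (hp : IsInvertibleSeries p) {x : ℝ} (hx : x ∈ Icc (-1 : ℝ) 1) :
    HasSum (fun n => absInvCoeff p n * x ^ n) (absSeries (invUnit (powerSum p)) x) := by
  rw [absSeries_invUnit_eq]
  exact hasSum_powerSum hp.summable_absInvCoeff (abs_le.2 hx)

/-- All terms are nonnegative, so the linear one is a lower bound. Both A(1) > 1 and the π/2 bound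
rest on this. -/
theorem inv_coeff_one_mul_le (hp : IsInvertibleSeries p) {y : ℝ} (hy : y ∈ Icc (0 : ℝ) 1) :
    (p 1)⁻¹ * y ≤ absSeries (invUnit (powerSum p)) y := by
  have h := le_hasSum (hp.hasSum_absSeries ⟨by linarith [hy.1], hy.2⟩) 1 fun n _ =>
    mul_nonneg (absInvCoeff_nonneg p n) (pow_nonneg hy.1 n)
  rwa [hp.absInvCoeff_one, pow_one] at h

theorem one_lt_absSeries_one (hp : IsInvertibleSeries p) :
    1 < absSeries (invUnit (powerSum p)) 1 := by
  have h := hp.inv_coeff_one_mul_le (y := 1) (by norm_num)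
  rw [mul_one] at h
  exact lt_of_lt_of_le ((one_lt_inv₀ hp.coeff_one_pos).2 hp.lt_one) h

theorem hyp_mem (hp : IsInvertibleSeries p) {y : ℝ}
    (hy : y ∈ Icc (0 : ℝ) (absSeries (invUnit (powerSum p)) 1)) :
    hypTransform (powerSum p) y ∈ Icc (-1 : ℝ) 1 := by
  have h1 := hp.one_lt_absSeries_one
  exact hp.bijOn_absSeries.surjOn.mapsTo_invFunOn ⟨by linarith [hy.1], hy.2⟩

theorem absSeries_hyp (hp : IsInvertibleSeries p) {y : ℝ}
    (hy : y ∈ Icc (0 : ℝ) (absSeries (invUnit (powerSum p)) 1)) :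
    absSeries (invUnit (powerSum p)) (hypTransform (powerSum p) y) = y := by
  have h1 := hp.one_lt_absSeries_one
  exact hp.bijOn_absSeries.invOn_invFunOn.2 ⟨by linarith [hy.1], hy.2⟩

theorem hyp_pos (hp : IsInvertibleSeries p) {y : ℝ}
    (hy : y ∈ Ioc (0 : ℝ) (absSeries (invUnit (powerSum p)) 1)) :
    0 < hypTransform (powerSum p) y := by
  have hy' := Ioc_subset_Icc_self hy
  rw [← hp.strictMonoOn.lt_iff_lt (a := 0) (by norm_num) (hp.hyp_mem hy'), hp.absSeries_zero,
    hp.absSeries_hyp hy']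
  exact hy.1

theorem hyp_lt_one (hp : IsInvertibleSeries p) {y : ℝ}
    (hy : y ∈ Ico (0 : ℝ) (absSeries (invUnit (powerSum p)) 1)) :
    hypTransform (powerSum p) y < 1 := by
  have hy' := Ico_subset_Icc_self hy
  rw [← hp.strictMonoOn.lt_iff_lt (b := 1) (hp.hyp_mem hy') (by norm_num), hp.absSeries_hyp hy']
  exact hy.2

/-- There is no constant term, and c^n ≤ c for n ≥ 1. With A(c) = 1 this yields 1/c ≤ A(1). -/
theorem absSeries_le_mul (hp : IsInvertibleSeries p) {c : ℝ} (hc : c ∈ Icc (0 : ℝ) 1) :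
    absSeries (invUnit (powerSum p)) c ≤ c * absSeries (invUnit (powerSum p)) 1 := by
  refine hasSum_le (fun n => ?_) (hp.hasSum_absSeries ⟨by linarith [hc.1], hc.2⟩)
    ((hp.hasSum_absSeries (x := 1) (by norm_num)).mul_left c)
  rcases n with _ | n
  · simp [hp.absInvCoeff_even 0 (by simp)]
  · rw [one_pow, mul_one, mul_comm c]
    refine mul_le_mul_of_nonneg_left ?_ (absInvCoeff_nonneg p _)
    rw [pow_succ]
    exact mul_le_of_le_one_left hc.1 (pow_le_one₀ hc.1 hc.2)

theorem one_mem (hp : IsInvertibleSeries p) :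
    (1 : ℝ) ∈ Ioo (0 : ℝ) (absSeries (invUnit (powerSum p)) 1) :=
  ⟨one_pos, hp.one_lt_absSeries_one⟩

theorem hyp_one_mem (hp : IsInvertibleSeries p) : hypTransform (powerSum p) 1 ∈ Ioo (0 : ℝ) 1 :=
  ⟨hp.hyp_pos (Ioo_subset_Ioc_self hp.one_mem), hp.hyp_lt_one (Ioo_subset_Ico_self hp.one_mem)⟩

theorem absSeries_hyp_one (hp : IsInvertibleSeries p) :
    absSeries (invUnit (powerSum p)) (hypTransform (powerSum p) 1) = 1 :=
  hp.absSeries_hyp (Ioo_subset_Icc_self hp.one_mem)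

end IsInvertibleSeries

/-! ### Positive semidefinite matrices -/

open scoped MatrixOrder in
theorem Matrix.PosSemidef.exists_sum_mul_eq {ι : Type*} [Fintype ι] {M : Matrix ι ι ℝ}
    (h : M.PosSemidef) : ∃ w : ι → ι → ℝ, ∀ a b, ∑ l, w a l * w b l = M a b := by
  classical
  obtain ⟨B, rfl⟩ := CStarAlgebra.nonneg_iff_eq_star_mul_self.mp h.nonneg
  exact ⟨fun a l => B l a, fun a b => by simp [Matrix.mul_apply, Matrix.star_apply]⟩

theorem posSemidef_real_iff {ι : Type*} [Fintype ι] {M : Matrix ι ι ℝ} :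
    M.PosSemidef ↔
      (∀ a b, M a b = M b a) ∧ ∀ x : ι → ℝ, 0 ≤ ∑ a, ∑ b, x a * M a b * x b := by
  rw [Matrix.posSemidef_iff_dotProduct_mulVec]
  have e : ∀ x : ι → ℝ, dotProduct (star x) (M.mulVec x) = ∑ a, ∑ b, x a * M a b * x b := by
    intro x
    simp only [dotProduct, Matrix.mulVec, Finset.mul_sum, Pi.star_apply, star_trivial, mul_assoc]
  constructor
  · rintro ⟨h1, h2⟩
    exact ⟨fun a b => (h1.apply a b).symm, fun x => (e x).symm ▸ h2 x⟩
  · rintro ⟨h1, h2⟩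
    exact ⟨Matrix.IsHermitian.ext fun a b => h1 b a, fun x => (e x).symm ▸ h2 x⟩

/-- Symmetry and nonnegativity of the quadratic form pass to entrywise convergent sums. This
replaces an infinite direct sum of tensor powers. -/
theorem posSemidef_of_hasSum {ι : Type*} [Fintype ι] {N : ℕ → Matrix ι ι ℝ} {M : Matrix ι ι ℝ}
    (hN : ∀ n, (N n).PosSemidef) (h : ∀ a b, HasSum (fun n => N n a b) (M a b)) :
    M.PosSemidef := by
  simp only [posSemidef_real_iff] at hN ⊢
  refine ⟨fun a b => ?_, fun x => ?_⟩
  · refine (h a b).unique ?_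
    simpa only [fun n => (hN n).1 a b] using h b a
  · have h1 : HasSum (fun n => ∑ a, ∑ b, x a * N n a b * x b) (∑ a, ∑ b, x a * M a b * x b) :=
      hasSum_sum fun a _ => hasSum_sum fun b _ => ((h a b).mul_left _).mul_right _
    exact h1.nonneg fun n => (hN n).2 x

/-- Schur product theorem, iterated; it plays the role of the Gram matrix of tensor powers. -/
theorem Matrix.PosSemidef.of_pow_apply {ι : Type*} [Fintype ι] {M : Matrix ι ι ℝ}
    (h : M.PosSemidef) (n : ℕ) : (Matrix.of fun a b => M a b ^ n).PosSemidef := by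
  induction n with
  | zero =>
    convert Matrix.posSemidef_vecMulVec_self_star (fun _ : ι => (1 : ℝ)) using 1
    ext a b
    simp [Matrix.vecMulVec_apply]
  | succ n ih =>
    have e : (Matrix.of fun a b => M a b ^ (n + 1)) =
        (Matrix.of fun a b => M a b ^ n).hadamard M := by
      ext a b
      simp [Matrix.hadamard_apply, pow_succ]
    rw [e]
    exact ih.hadamard h

/-- Vectors in the unit ball can be completed to unit vectors without changing the inner products
of the vectors with different indices. -/
theorem exists_posSemidef_gram_completion {ι : Type*} [Fintype ι] [DecidableEq ι] {H : Type*}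
    [NormedAddCommGroup H] [InnerProductSpace ℝ H] (x : ι → H) (hx : ∀ a, ‖x a‖ ≤ 1) :
    ∃ G : Matrix ι ι ℝ, G.PosSemidef ∧ (∀ a, G a a = 1) ∧ (∀ a b, |G a b| ≤ 1) ∧
      ∀ a b, a ≠ b → G a b = inner ℝ (x a) (x b) := by
  -- The diagonal defect corresponds to adding to each vector a component in a private orthogonal
  -- direction.
  set D : Matrix ι ι ℝ := Matrix.diagonal fun a => 1 - ‖x a‖ ^ 2 with hD
  have h1 : ∀ a, (Matrix.gram ℝ x + D) a a = 1 := by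
    intro a
    simp [hD, Matrix.gram_apply]
  have h2 : ∀ a b, a ≠ b → (Matrix.gram ℝ x + D) a b = inner ℝ (x a) (x b) := by
    intro a b hab
    simp [hD, Matrix.gram_apply, hab]
  refine ⟨Matrix.gram ℝ x + D,
    (Matrix.posSemidef_gram ℝ x).add (Matrix.PosSemidef.diagonal fun a => ?_), h1, ?_, h2⟩
  · have := pow_le_one₀ (n := 2) (norm_nonneg _) (hx a)
    simpa using this
  · intro a b
    by_cases hab : a = b
    · rw [hab, h1, abs_one]
    · rw [h2 a b hab]
      refine (abs_real_inner_le_norm _ _).trans ?_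
      exact mul_le_one₀ (hx a) (norm_nonneg _) (hx b)

/-- The preprocessing step of Krivine's rounding scheme. -/
theorem exists_krivine_vectors {p : ℕ → ℝ} (hp : IsInvertibleSeries p) {m n : ℕ}
    {H : Type*} [NormedAddCommGroup H] [InnerProductSpace ℝ H] {u : Fin m → H} {v : Fin n → H}
    (hu : ∀ i, ‖u i‖ ≤ 1) (hv : ∀ j, ‖v j‖ ≤ 1) :
    ∃ w : Fin m ⊕ Fin n → Fin m ⊕ Fin n → ℝ, (∀ a, ∑ l, w a l ^ 2 = 1) ∧
      ∀ i j, powerSum p (∑ l, w (Sum.inl i) l * w (Sum.inr j) l) =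
        hypTransform (powerSum p) 1 * inner ℝ (u i) (v j) := by
  obtain ⟨G, hG, hG1, hGle, hGin⟩ := exists_posSemidef_gram_completion (Sum.elim u v)
    (by rintro (i | j); exacts [hu i, hv j])
  obtain ⟨hc0, hc1⟩ := hp.hyp_one_mem
  have hA := hp.absSeries_hyp_one
  set c := hypTransform (powerSum p) 1
  set b := maclaurinCoeff (invUnit (powerSum p)) with hb
  have hcG : ∀ a a', ‖c * G a a'‖ ≤ 1 := by
    intro a a'
    rw [norm_mul, Real.norm_eq_abs, Real.norm_eq_abs, abs_of_pos hc0]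
    exact mul_le_one₀ hc1.le (abs_nonneg _) (hGle a a')
  -- Signs are attached to the second family only: diagonal entries then see |b_k|, while the cross
  -- entries recover b_k itself.
  set s : ℕ → Fin m ⊕ Fin n → ℝ := fun k => Sum.elim (fun _ => 1) (fun _ => Real.sign (b k))
    with hs
  -- The Gram matrix of the vectors √(|b_k| c^k) s_k(a) x_a^{⊗k}, where x is the completed family of
  -- unit vectors.
  set N : ℕ → Matrix (Fin m ⊕ Fin n) (Fin m ⊕ Fin n) ℝ := fun k =>
    (|b k| * c ^ k) • (Matrix.vecMulVec (s k) (star (s k))).hadamard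
      (Matrix.of fun a a' => G a a' ^ k) with hN
  have hNp : ∀ k, (N k).PosSemidef := fun k =>
    ((Matrix.posSemidef_vecMulVec_self_star (s k)).hadamard (hG.of_pow_apply k)).smul
      (by positivity)
  have hNa : ∀ k a a', N k a a' = (|b k| * (s k a * s k a')) * (c * G a a') ^ k := by
    intro k a a'
    simp [hN, Matrix.hadamard_apply, Matrix.vecMulVec_apply]
    ring
  have hsign : ∀ y : ℝ, |y| * Real.sign y = y := by
    intro y
    rcases lt_trichotomy y 0 with h | h | h
    · rw [Real.sign_of_neg h, abs_of_neg h]; ring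
    · simp [h]
    · rw [Real.sign_of_pos h, abs_of_pos h]; ring
  have hsign2 : ∀ y : ℝ, |y| * (Real.sign y * Real.sign y) = |y| := by
    intro y
    rcases lt_trichotomy y 0 with h | h | h
    · rw [Real.sign_of_neg h]; ring
    · simp [h]
    · rw [Real.sign_of_pos h]; ring
  have hsle : ∀ k a a', |s k a * s k a'| ≤ 1 := by
    have h1 : ∀ k a, |s k a| ≤ 1 := by
      rintro k (i | j)
      · simp [hs]
      · simp only [hs, Sum.elim_inr]
        rcases Real.sign_apply_eq (b k) with h | h | h <;> simp [h]
    intro k a a'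
    rw [abs_mul]
    exact mul_le_one₀ (h1 k a) (abs_nonneg _) (h1 k a')
  have hsum : ∀ a a', Summable fun k => N k a a' := by
    intro a a'
    simp only [hNa]
    refine summable_mul_pow (Summable.of_nonneg_of_le (fun _ => norm_nonneg _) (fun k => ?_)
      hp.analytic.summable_norm) (hcG a a')
    rw [norm_mul, Real.norm_eq_abs, abs_abs, ← Real.norm_eq_abs]
    exact mul_le_of_le_one_right (norm_nonneg _) (hsle k a a')
  have hM : (Matrix.of fun a a' => ∑' k, N k a a').PosSemidef :=
    posSemidef_of_hasSum hNp fun a a' => (hsum a a').hasSum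
  obtain ⟨w, hw⟩ := hM.exists_sum_mul_eq
  refine ⟨w, fun a => ?_, fun i j => ?_⟩
  -- The diagonal entries sum to A(c) = 1. A vanishing b_k does no harm, since |b_k| sign(b_k)² =
  -- |b_k| in every case.
  · have h1 := hw a a
    simp only [← sq, Matrix.of_apply] at h1
    rw [h1, ← hA, absSeries_invUnit_eq, powerSum]
    congr 1
    ext k
    rw [hNa, hG1, mul_one, absInvCoeff, ← hb]
    congr 1
    rcases a with i | j
    · simp [hs]
    · simp only [hs, Sum.elim_inr]
      exact hsign2 _
  · have h1 := hw (Sum.inl i) (Sum.inr j)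
    have h2 : ∑' k, N k (Sum.inl i) (Sum.inr j) =
        powerSum b (c * G (Sum.inl i) (Sum.inr j)) := by
      rw [powerSum]
      congr 1
      ext k
      rw [hNa]
      simp only [hs, Sum.elim_inl, Sum.elim_inr, one_mul]
      rw [hsign]
    have h3 := hGin (Sum.inl i) (Sum.inr j) (by simp)
    simp only [Sum.elim_inl, Sum.elim_inr] at h3
    -- Strict inequality matters: the inverse is known to equal its Maclaurin series on the open
    -- interval only.
    have h4 : |c * G (Sum.inl i) (Sum.inr j)| < 1 := by
      rw [abs_mul, abs_of_pos hc0]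
      exact lt_of_le_of_lt (mul_le_of_le_one_right hc0.le (hGle _ _)) hc1
    have h5 := hp.analytic.eqOn_powerSum (abs_lt.1 h4)
    rw [h1, Matrix.of_apply, h2, ← h5, hp.powerSum_invUnit (abs_le.1 h4.le), h3]

/-! ### The Grothendieck constant -/

theorem le_normInfOne {m n : ℕ} (A : Matrix (Fin m) (Fin n) ℝ) {p : Fin m → ℝ} {q : Fin n → ℝ}
    (hp : ∀ i, |p i| ≤ 1) (hq : ∀ j, |q j| ≤ 1) :
    |∑ i, ∑ j, A i j * p i * q j| ≤ normInfOne A := by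
  -- The sum of the absolute entries bounds the set above, so the supremum is not the default value
  -- of `sSup`.
  refine le_csSup ⟨∑ i, ∑ j, |A i j|, ?_⟩ ⟨p, q, hp, hq, rfl⟩
  rintro _ ⟨p, q, hp, hq, rfl⟩
  refine (Finset.abs_sum_le_sum_abs _ _).trans (Finset.sum_le_sum fun i _ => ?_)
  refine (Finset.abs_sum_le_sum_abs _ _).trans (Finset.sum_le_sum fun j _ => ?_)
  rw [abs_mul, abs_mul, mul_assoc]
  exact mul_le_of_le_one_right (abs_nonneg _) (mul_le_one₀ (hp i) (abs_nonneg _) (hq j))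

/-- Tested on the 1×1 matrix with entry 1. -/
theorem one_le_of_mem_grothendieckAdmissible {K : ℝ} (hK : K ∈ grothendieckAdmissible) :
    1 ≤ K := by
  have h := hK.2 1 1 (fun _ _ => 1) ℝ (fun _ => 1) (fun _ => 1) (by simp) (by simp)
  have h1 : normInfOne (fun _ _ => 1 : Matrix (Fin 1) (Fin 1) ℝ) ≤ 1 := by
    refine csSup_le ⟨_, 0, 0, by simp, by simp, rfl⟩ ?_
    rintro _ ⟨p, q, hp, hq, rfl⟩
    simp only [Finset.univ_unique, Finset.sum_singleton, one_mul, abs_mul]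
    exact mul_le_one₀ (hp _) (abs_nonneg _) (hq _)
  simp at h
  exact h.trans (mul_le_of_le_one_right hK.1.le h1)

/-- Each instance of the inequality is a closed condition on K, so the infimum inherits it; the
lower bound 1 keeps the infimum positive. -/
theorem isLeast_grothendieckConstant (h : grothendieckAdmissible.Nonempty) :
    IsLeast grothendieckAdmissible grothendieckConstant := by
  have hb : BddBelow grothendieckAdmissible :=
    ⟨1, fun K hK => one_le_of_mem_grothendieckAdmissible hK⟩
  refine ⟨⟨?_, ?_⟩, fun K hK => csInf_le hb hK⟩
  · exact lt_of_lt_of_le one_pos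
      (le_csInf h fun K hK => one_le_of_mem_grothendieckAdmissible hK)
  · intro m n A H _ _ _ u v hu hv
    have hcl : IsClosed {K : ℝ | |∑ i, ∑ j, A i j * inner ℝ (u i) (v j)| ≤ K * normInfOne A} :=
      isClosed_le continuous_const (by fun_prop)
    exact closure_minimal (fun K hK => hK.2 m n A H u v hu hv) hcl (csInf_mem_closure h hb)

theorem integral_sum_sum_mul {ι κ Ω : Type*} [Fintype ι] [Fintype κ] [MeasurableSpace Ω]
    {μ : Measure Ω} (A : ι → κ → ℝ) {F : ι → κ → Ω → ℝ} (hF : ∀ i j, Integrable (F i j) μ) :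
    ∫ x, ∑ i, ∑ j, A i j * F i j x ∂μ = ∑ i, ∑ j, A i j * ∫ x, F i j x ∂μ := by
  rw [integral_finsetSum _ fun i _ => integrable_finsetSum _ fun j _ => (hF i j).const_mul _]
  refine Finset.sum_congr rfl fun i _ => ?_
  rw [integral_finsetSum _ fun j _ => (hF i j).const_mul _]
  simp only [integral_const_mul]

/-- The upper bound that a completely real analytic inverse yields. -/
theorem linftyNorm_sq_div_hyp_mem_grothendieckAdmissible {k : ℕ} {f : (Fin k → ℝ) → ℝ}
    (hf : MemLp f ∞ (gaussMeasure k)) (h1 : 1 ≤ linftyNorm f)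
    (hp : IsInvertibleSeries (corrCoeff f f)) :
    linftyNorm f ^ 2 / hypTransform (corrFun f f) 1 ∈ grothendieckAdmissible := by
  rw [corrFun_eq_powerSum]
  have hc0 := hp.hyp_one_mem.1
  have hM0 : 0 < linftyNorm f := one_pos.trans_le h1
  refine ⟨by positivity, ?_⟩
  intro m n A H _ _ _ u v hu hv
  obtain ⟨w, hw, hwc⟩ := exists_krivine_vectors hp hu hv
  set c := hypTransform (powerSum (corrCoeff f f)) 1
  set M := linftyNorm f
  have hf2 := memLp_two_of_memLp_top hf
  have mp := fun a => measurePreserving_gaussProj k (hw a)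
  have hI : ∀ i j, ∫ g, f (gaussProj k (w (Sum.inl i)) g) * f (gaussProj k (w (Sum.inr j)) g)
      ∂gaussArray k (Fin m ⊕ Fin n) = c * inner ℝ (u i) (v j) := fun i j => by
    rw [integral_gaussProj_mul_gaussProj hf2 (hw _) (hw _), ← hwc, corrFun_eq_powerSum]
  have hint : ∀ i j, Integrable (fun g => f (gaussProj k (w (Sum.inl i)) g) *
      f (gaussProj k (w (Sum.inr j)) g)) (gaussArray k (Fin m ⊕ Fin n)) := fun i j =>
    (hf2.comp_measurePreserving (mp _)).integrable_mul (hf2.comp_measurePreserving (mp _))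
  have hae : ∀ᵐ g ∂gaussArray k (Fin m ⊕ Fin n), ∀ a, |f (gaussProj k (w a) g)| ≤ M :=
    ae_all_iff.2 fun a => (mp a).quasiMeasurePreserving.ae (ae_abs_le_linftyNorm hf)
  have hsum : c * ∑ i, ∑ j, A i j * inner ℝ (u i) (v j) =
      ∫ g, ∑ i, ∑ j, A i j * (f (gaussProj k (w (Sum.inl i)) g) *
        f (gaussProj k (w (Sum.inr j)) g)) ∂gaussArray k (Fin m ⊕ Fin n) := by
    refine Eq.trans ?_ (integral_sum_sum_mul A hint).symm
    simp only [hI, Finset.mul_sum]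
    exact Finset.sum_congr rfl fun i _ => Finset.sum_congr rfl fun j _ => mul_left_comm _ _ _
  have hbound : |c * ∑ i, ∑ j, A i j * inner ℝ (u i) (v j)| ≤ M ^ 2 * normInfOne A := by
    rw [hsum, ← Real.norm_eq_abs]
    have h := norm_integral_le_of_norm_le_const (μ := gaussArray k (Fin m ⊕ Fin n))
      (f := fun g => ∑ i, ∑ j, A i j * (f (gaussProj k (w (Sum.inl i)) g) *
        f (gaussProj k (w (Sum.inr j)) g))) (C := M ^ 2 * normInfOne A) ?_
    · simpa using h
    · filter_upwards [hae] with g hg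
      -- For almost every sample the values of f divided by M lie in [-1,1] and are admissible in
      -- the supremum.
      have h2 := le_normInfOne A (p := fun i => f (gaussProj k (w (Sum.inl i)) g) / M)
        (q := fun j => f (gaussProj k (w (Sum.inr j)) g) / M)
        (fun i => by rw [abs_div, abs_of_pos hM0, div_le_one hM0]; exact hg _)
        (fun j => by rw [abs_div, abs_of_pos hM0, div_le_one hM0]; exact hg _)
      have e : ∑ i, ∑ j, A i j * (f (gaussProj k (w (Sum.inl i)) g) *
          f (gaussProj k (w (Sum.inr j)) g)) =
          M ^ 2 * ∑ i, ∑ j, A i j * (f (gaussProj k (w (Sum.inl i)) g) / M) *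
            (f (gaussProj k (w (Sum.inr j)) g) / M) := by
        simp only [Finset.mul_sum]
        refine Finset.sum_congr rfl fun i _ => Finset.sum_congr rfl fun j _ => ?_
        field_simp
      rw [e, Real.norm_eq_abs, abs_mul, abs_of_nonneg (sq_nonneg M)]
      exact mul_le_mul_of_nonneg_left h2 (sq_nonneg M)
  rw [abs_mul, abs_of_pos hc0] at hbound
  rw [div_mul_eq_mul_div, le_div_iff₀ hc0, mul_comm]
  exact hbound

/-! ### The complex extension -/

theorem powerSum_ofReal (a : ℕ → ℝ) (x : ℝ) :
    powerSum (fun n => (a n : ℂ)) (x : ℂ) = ((powerSum a x : ℝ) : ℂ) := by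
  simp only [powerSum, Complex.ofReal_tsum]
  push_cast
  rfl

theorem summable_norm_ofReal {a : ℕ → ℝ} (ha : Summable fun n => ‖a n‖) :
    Summable fun n => ‖(a n : ℂ)‖ := by
  simpa only [Complex.norm_real] using ha

namespace IsInvertibleSeries

variable {p : ℕ → ℝ}

theorem norm_powerSum_maclaurinCoeff_le (hp : IsInvertibleSeries p) {z : ℂ} (hz : ‖z‖ ≤ 1) :
    ‖powerSum (fun n => (maclaurinCoeff (invUnit (powerSum p)) n : ℂ)) z‖ ≤
      absSeries (invUnit (powerSum p)) ‖z‖ := by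
  refine (tsum_of_norm_bounded (hp.hasSum_absSeries (x := ‖z‖)
    ⟨by linarith [norm_nonneg z], hz⟩) fun n => ?_)
  rw [norm_mul, norm_pow, Complex.norm_real, absInvCoeff, Real.norm_eq_abs]

/-- The complex extensions of a series and of its inverse are inverse to each other on the disc
whose radius is the value of the hyperbolic transform at one. -/
theorem powerSum_comp_maclaurinCoeff (hp : IsInvertibleSeries p) {z : ℂ}
    (hz : ‖z‖ ≤ hypTransform (powerSum p) 1) :
    powerSum (fun n => (p n : ℂ))
      (powerSum (fun n => (maclaurinCoeff (invUnit (powerSum p)) n : ℂ)) z) = z := by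
  obtain ⟨hc0, hc1⟩ := hp.hyp_one_mem
  have hA := hp.absSeries_hyp_one
  set c := hypTransform (powerSum p) 1
  set b := maclaurinCoeff (invUnit (powerSum p)) with hb
  have hbs := summable_norm_ofReal hp.analytic.summable_norm
  have hps := summable_norm_ofReal hp.summable_norm
  -- By the triangle inequality the inverse series is at most A(‖z‖) < A(c) = 1 in modulus, so the
  -- composition stays inside the disc of analyticity.
  have hlt : ∀ z : ℂ, ‖z‖ < c → ‖powerSum (fun n => (b n : ℂ)) z‖ < 1 := by
    intro z hz
    refine (hp.norm_powerSum_maclaurinCoeff_le (hz.le.trans hc1.le)).trans_lt ?_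
    rw [← hA]
    exact hp.strictMonoOn ⟨by linarith [norm_nonneg z], hz.le.trans hc1.le⟩
      ⟨by linarith, hc1.le⟩ hz
  have hle : ∀ z : ℂ, ‖z‖ ≤ c → ‖powerSum (fun n => (b n : ℂ)) z‖ ≤ 1 := by
    intro z hz
    refine (hp.norm_powerSum_maclaurinCoeff_le (hz.trans hc1.le)).trans ?_
    rw [← hA]
    exact hp.strictMonoOn.monotoneOn ⟨by linarith [norm_nonneg z], hz.trans hc1.le⟩
      ⟨by linarith, hc1.le⟩ hz
  have han : AnalyticOnNhd ℂ
      (powerSum (fun n => (p n : ℂ)) ∘ powerSum (fun n => (b n : ℂ))) (Metric.ball 0 c) := by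
    refine (analyticOnNhd_powerSum hps).comp
      ((analyticOnNhd_powerSum hbs).mono (Metric.ball_subset_ball hc1.le)) fun z hz => ?_
    rw [mem_ball_zero_iff] at hz ⊢
    exact hlt z hz
  have hreal : ∀ x : ℝ, x ∈ Ioo (-1 : ℝ) 1 →
      (powerSum (fun n => (p n : ℂ)) ∘ powerSum (fun n => (b n : ℂ))) (x : ℂ) = x := by
    intro x hx
    rw [Function.comp_apply, powerSum_ofReal, powerSum_ofReal, hb, ← hp.analytic.eqOn_powerSum hx,
      hp.powerSum_invUnit (Ioo_subset_Icc_self hx)]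
  -- Agreement on the real axis accumulates at 0, which is enough for the identity theorem on the
  -- disc.
  have hfreq : ∃ᶠ z in nhdsWithin (0 : ℂ) {0}ᶜ,
      (powerSum (fun n => (p n : ℂ)) ∘ powerSum (fun n => (b n : ℂ))) z = id z := by
    have ht : Filter.Tendsto (fun x : ℝ => (x : ℂ)) (nhdsWithin 0 {0}ᶜ)
        (nhdsWithin (0 : ℂ) {0}ᶜ) := by
      refine tendsto_nhdsWithin_iff.2 ⟨?_, ?_⟩
      · exact (Complex.continuous_ofReal.tendsto' 0 0 (by simp)).mono_left nhdsWithin_le_nhds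
      · filter_upwards [self_mem_nhdsWithin] with x hx
        simpa using hx
    refine ht.frequently (Filter.Eventually.frequently ?_)
    filter_upwards [nhdsWithin_le_nhds (Ioo_mem_nhds (show (-1 : ℝ) < 0 by norm_num) one_pos)]
      with x hx
    exact hreal x hx
  have h1 : EqOn (powerSum (fun n => (p n : ℂ)) ∘ powerSum (fun n => (b n : ℂ))) id
      (Metric.ball 0 c) :=
    han.eqOn_of_preconnected_of_frequently_eq analyticOnNhd_id
      (convex_ball _ _).isPreconnected (Metric.mem_ball_self hc0) hfreq
  -- Continuity carries the identity to the boundary circle, where the point ic lies.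
  have h2 : EqOn (powerSum (fun n => (p n : ℂ)) ∘ powerSum (fun n => (b n : ℂ))) id
      (Metric.closedBall 0 c) := by
    refine h1.of_subset_closure ?_ continuousOn_id Metric.ball_subset_closedBall
      (closure_ball (0 : ℂ) hc0.ne').ge
    refine (continuousOn_powerSum hps).comp ((continuousOn_powerSum hbs).mono fun z hz => ?_)
      fun z hz => ?_
    · exact (mem_closedBall_zero_iff.1 hz).trans hc1.le
    · exact hle z (mem_closedBall_zero_iff.1 hz)
  exact h2 (mem_closedBall_zero_iff.2 hz)

/-- The alternating signs cancel the factors i^{2m} = (-1)^m, so the inverse series maps ic to iA(c)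
= i; then the complex extension of h is applied. -/
theorem powerSum_I_of_sign (hp : IsInvertibleSeries p)
    (hs : ∀ n : ℕ, Real.sign (iteratedDeriv (2 * n + 1) (invUnit (powerSum p)) 0) = (-1) ^ n) :
    powerSum (fun n => (p n : ℂ)) Complex.I = Complex.I * hypTransform (powerSum p) 1 := by
  obtain ⟨hc0, hc1⟩ := hp.hyp_one_mem
  have h := hp.powerSum_comp_maclaurinCoeff
    (z := Complex.I * (hypTransform (powerSum p) 1 : ℝ)) (by
      rw [norm_mul, Complex.norm_I, one_mul, Complex.norm_real, Real.norm_of_nonneg hc0.le])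
  have hA := hp.absSeries_hyp_one
  set c := hypTransform (powerSum p) 1
  have e : powerSum (fun n => (maclaurinCoeff (invUnit (powerSum p)) n : ℂ)) (Complex.I * c) =
      Complex.I := by
    have h1 : ∀ n, (maclaurinCoeff (invUnit (powerSum p)) n : ℂ) * (Complex.I * c) ^ n =
        Complex.I * ((absInvCoeff p n * c ^ n : ℝ) : ℂ) := by
      intro n
      rcases Nat.even_or_odd' n with ⟨m, rfl | rfl⟩
      · rw [hp.absInvCoeff_even _ (even_two_mul m),
          hp.maclaurinCoeff_invUnit_even _ (even_two_mul m)]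
        simp
      · have h2 : maclaurinCoeff (invUnit (powerSum p)) (2 * m + 1) =
            (-1) ^ m * absInvCoeff p (2 * m + 1) := by
          have h3 := hs m
          rw [absInvCoeff, maclaurinCoeff, abs_div, Nat.abs_cast, ← h3, ← mul_div_assoc]
          congr 1
          set y := iteratedDeriv (2 * m + 1) (invUnit (powerSum p)) 0
          rcases lt_trichotomy y 0 with h | h | h
          · rw [Real.sign_of_neg h, abs_of_neg h]; ring
          · simp [h]
          · rw [Real.sign_of_pos h, abs_of_pos h]; ring
        rw [h2, mul_pow, pow_succ Complex.I, pow_mul Complex.I, Complex.I_sq]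
        push_cast
        have h4 : ((-1 : ℂ) ^ m) * (-1) ^ m = 1 := by rw [← mul_pow]; simp
        linear_combination (Complex.I * (absInvCoeff p (2 * m + 1) : ℂ) * c ^ (2 * m + 1)) * h4
    rw [powerSum]
    simp only [h1]
    rw [tsum_mul_left, ← Complex.ofReal_tsum,
      (hp.hasSum_absSeries (x := c) ⟨by linarith, hc1.le⟩).tsum_eq, hA]
    simp
  rwa [e] at h

end IsInvertibleSeries

theorem complexSeries_powerSum {p : ℕ → ℝ} (hp : Summable fun n => ‖p n‖) :
    complexSeries (powerSum p) = powerSum fun n => (p n : ℂ) := by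
  rw [complexSeries_eq_powerSum]
  simp only [iteratedDeriv_powerSum hp]

/-! ### Termwise differentiation -/

/-- Polynomial growth of the coefficients is preserved by differentiation, with k raised by one, so
the lemma can be applied repeatedly. -/
theorem hasDerivAt_powerSum {a : ℕ → ℝ} {C : ℝ} {k : ℕ} (ha : ∀ n, |a n| ≤ C * ((n : ℝ) + 1) ^ k)
    {x : ℝ} (hx : x ∈ Ioo (-1 : ℝ) 1) :
    HasDerivAt (powerSum a) (powerSum (fun n => ((n : ℝ) + 1) * a (n + 1)) x) x ∧
      Summable fun n => a n * x ^ n := by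
  obtain ⟨r, hxr, hr1⟩ := exists_between (abs_lt.2 hx)
  have hr0 : 0 ≤ r := (abs_nonneg x).trans hxr.le
  have hC : 0 ≤ C := by simpa using (abs_nonneg _).trans (ha 0)
  have hu0 : ∀ j : ℕ, Summable fun n : ℕ => ((n : ℝ) + 1) ^ j * r ^ n := by
    intro j
    by_cases hr : r = 0
    · refine summable_of_ne_finset_zero (s := {0}) fun n hn => ?_
      rw [hr, zero_pow (by simpa using hn), mul_zero]
    have h := (summable_nat_add_iff 1).2
      (summable_pow_mul_geometric_of_norm_lt_one j (r := r) (by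
        rwa [Real.norm_of_nonneg hr0]))
    refine (h.mul_left r⁻¹).congr fun n => ?_
    push_cast
    rw [pow_succ]
    field_simp
  have hS : ∀ y : ℝ, |y| ≤ r → Summable fun n => a n * y ^ n := by
    intro y hy
    refine Summable.of_norm_bounded ((hu0 k).mul_left C) fun n => ?_
    rw [norm_mul, norm_pow, ← mul_assoc]
    exact mul_le_mul (ha n) (pow_le_pow_left₀ (norm_nonneg _) hy n) (by positivity) (by positivity)
  refine ⟨?_, hS x hxr.le⟩
  -- A majorant of the differentiated terms. The truncated exponent is harmless at n = 0, where the
  -- derivative term vanishes.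
  have hu : Summable fun n : ℕ => C * ((n : ℝ) + 1) ^ (k + 1) * r ^ (n - 1) := by
    refine (summable_nat_add_iff 1).1 ?_
    have h := (hu0 (k + 1)).mul_left (C * 2 ^ (k + 1))
    refine Summable.of_nonneg_of_le (fun n => by positivity) (fun n => ?_) h
    simp only [Nat.add_sub_cancel]
    have h1 : (((n + 1 : ℕ) : ℝ) + 1) ^ (k + 1) ≤ 2 ^ (k + 1) * ((n : ℝ) + 1) ^ (k + 1) := by
      rw [← mul_pow]
      refine pow_le_pow_left₀ (by positivity) ?_ _
      push_cast
      have : (0 : ℝ) ≤ n := Nat.cast_nonneg n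
      linarith
    calc C * (((n + 1 : ℕ) : ℝ) + 1) ^ (k + 1) * r ^ n
        ≤ C * (2 ^ (k + 1) * ((n : ℝ) + 1) ^ (k + 1)) * r ^ n := by gcongr
      _ = _ := by ring
  have hd := hasDerivAt_tsum_of_isPreconnected (g := fun n y => a n * y ^ n)
    (g' := fun n y => a n * ((n : ℝ) * y ^ (n - 1))) hu isOpen_Ioo
    (isPreconnected_Ioo (a := -r) (b := r))
    (fun n y _ => (hasDerivAt_pow n y).const_mul (a n))
    (fun n y hy => by
      rw [norm_mul, norm_mul, norm_pow, Real.norm_natCast, pow_succ, ← mul_assoc, ← mul_assoc]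
      have hy' : ‖y‖ ≤ r := abs_le.2 ⟨hy.1.le, hy.2.le⟩
      have h1 : ‖a n‖ * n ≤ C * ((n : ℝ) + 1) ^ k * (n + 1) :=
        mul_le_mul (ha n) (by linarith) (by positivity) (by positivity)
      exact mul_le_mul h1 (pow_le_pow_left₀ (norm_nonneg _) hy' _) (by positivity) (by positivity))
    (abs_lt.1 hxr) (hS x hxr.le) (abs_lt.1 hxr)
  have hs' : Summable fun n => a n * ((n : ℝ) * x ^ (n - 1)) := by
    refine Summable.of_norm_bounded hu fun n => ?_
    rw [norm_mul, norm_mul, norm_pow, Real.norm_natCast, pow_succ, ← mul_assoc, ← mul_assoc]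
    have h1 : ‖a n‖ * n ≤ C * ((n : ℝ) + 1) ^ k * (n + 1) :=
      mul_le_mul (ha n) (by linarith) (by positivity) (by positivity)
    exact mul_le_mul h1 (pow_le_pow_left₀ (norm_nonneg _) hxr.le _) (by positivity) (by positivity)
  refine hd.congr_deriv ?_
  rw [hs'.tsum_eq_zero_add, powerSum]
  simp only [Nat.cast_zero, zero_mul, mul_zero, zero_add, Nat.add_sub_cancel]
  congr 1
  ext n
  push_cast
  ring

/-! ### The sign function -/

theorem measurable_realSign : Measurable Real.sign := by
  unfold Real.sign
  exact Measurable.ite (measurableSet_lt measurable_id measurable_const) measurable_const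
    (Measurable.ite (measurableSet_lt measurable_const measurable_id) measurable_const
      measurable_const)

theorem measurable_signFun : Measurable signFun :=
  measurable_realSign.comp (measurable_pi_apply 0)

theorem abs_realSign_le (y : ℝ) : |Real.sign y| ≤ 1 := by
  rcases Real.sign_apply_eq y with h | h | h <;> simp [h]

theorem memLp_top_signFun : MemLp signFun ∞ (gaussMeasure 1) :=
  memLp_top_of_bound measurable_signFun.aestronglyMeasurable 1
    (ae_of_all _ fun _ => abs_realSign_le _)

theorem ae_ne_zero_gaussMeasure_one : ∀ᵐ x ∂gaussMeasure 1, x 0 ≠ 0 := by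
  have h : ∀ᵐ y ∂stdGauss, y ≠ 0 := by
    have := nullSingletonClass_gaussianReal (μ := 0) (v := 1) one_ne_zero
    exact ae_iff.2 (by simp)
  exact (measurePreserving_eval (fun _ : Fin 1 => stdGauss) 0).quasiMeasurePreserving.ae h

theorem eLpNorm_signFun {q : ℝ≥0∞} (hq : q ≠ 0) : eLpNorm signFun q (gaussMeasure 1) = 1 := by
  have h : eLpNorm signFun q (gaussMeasure 1) =
      eLpNorm (fun _ : Fin 1 → ℝ => (1 : ℝ)) q (gaussMeasure 1) := by
    refine eLpNorm_congr_norm_ae ?_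
    filter_upwards [ae_ne_zero_gaussMeasure_one] with x hx
    rcases Real.sign_apply_eq_of_ne_zero _ hx with h | h <;> simp [signFun, h]
  rw [h, eLpNorm_const _ hq (IsProbabilityMeasure.ne_zero _)]
  simp

theorem linftyNorm_signFun : linftyNorm signFun = 1 := by
  rw [linftyNorm, eLpNorm_signFun (by simp), ENNReal.toReal_one]

theorem isOddAE_signFun : IsOddAE signFun :=
  ae_of_all _ fun x => by simp [signFun, Real.sign_neg]

theorem hermiteCoeff_signFun (α : Fin 1 → ℕ) :
    hermiteCoeff signFun α =
      (√((α 0)! : ℝ))⁻¹ * ∫ y, Real.sign y * (hermiteReal (α 0)).eval y ∂stdGauss := by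
  have m := measurePreserving_eval (fun _ : Fin 1 => stdGauss) 0
  have hmeas : Measurable fun y => Real.sign y * (hermiteReal (α 0)).eval y :=
    measurable_realSign.mul (by fun_prop)
  rw [hermiteCoeff, ← integral_const_mul, ← m.map_eq,
    integral_map m.aemeasurable (hmeas.const_mul _).aestronglyMeasurable]
  refine integral_congr_ae (ae_of_all _ fun x => ?_)
  simp [hermiteFun_eq_prod, signFun]
  ring

/-- Since the polynomial is odd, the integrand is its value at |y|, including y = 0 where both
vanish. The integral is thus twice the one over the half-line. -/
theorem integral_sign_mul_hermiteReal_succ {n : ℕ} (hn : Even n) :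
    ∫ y, Real.sign y * (hermiteReal (n + 1)).eval y ∂stdGauss =
      2 * gaussianPDFReal 0 1 0 * (hermiteReal n).eval 0 := by
  have hodd : Odd (n + 1) := hn.add_one
  rw [stdGauss, integral_gaussianReal_eq_integral_smul one_ne_zero, mul_assoc,
    ← integral_Ioi_gaussianPDFReal_mul_hermiteReal_succ n,
    ← integral_comp_abs (f := fun y => gaussianPDFReal 0 1 y * (hermiteReal (n + 1)).eval y)]
  congr 1
  ext y
  have h1 : gaussianPDFReal 0 1 |y| = gaussianPDFReal 0 1 y := by simp [gaussianPDFReal]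
  rw [smul_eq_mul, h1]
  congr 1
  rcases lt_trichotomy y 0 with h | h | h
  · rw [Real.sign_of_neg h, abs_of_neg h, eval_neg_hermiteReal, hodd.neg_one_pow]
  · have h0 := eval_neg_hermiteReal (n + 1) 0
    rw [hodd.neg_one_pow, neg_zero] at h0
    rw [h, Real.sign_zero, abs_zero]
    linarith
  · rw [Real.sign_of_pos h, abs_of_pos h, one_mul]

theorem eval_zero_hermiteReal_add_two (n : ℕ) :
    (hermiteReal (n + 2)).eval 0 = -((n : ℝ) + 1) * (hermiteReal n).eval 0 := by
  rw [hermiteReal_succ (n + 1), derivative_hermiteReal_succ]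
  simp
  ring

theorem corrCoeff_signFun (ν : ℕ) :
    corrCoeff signFun signFun ν = hermiteCoeff signFun (fun _ => ν) ^ 2 := by
  have h : Finset.piAntidiag (Finset.univ : Finset (Fin 1)) ν = {fun _ => ν} := by
    ext α
    simp only [Finset.mem_piAntidiag, Finset.univ_unique, Finset.sum_singleton,
      Finset.mem_singleton, Fin.default_eq_zero]
    exact ⟨fun h => funext fun i => by rw [Subsingleton.elim i 0, h.1],
      fun h => ⟨by rw [h], fun i _ => Subsingleton.elim _ _⟩⟩
  rw [corrCoeff, h, Finset.sum_singleton, sq]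

theorem corrCoeff_signFun_succ (n : ℕ) :
    corrCoeff signFun signFun (n + 1) =
      2 / Real.pi * ((hermiteReal n).eval 0 ^ 2 / ((n + 1)! : ℝ)) := by
  rcases Nat.even_or_odd n with hn | hn
  · rw [corrCoeff_signFun, hermiteCoeff_signFun, integral_sign_mul_hermiteReal_succ hn, mul_pow,
      mul_pow, two_mul_gaussianPDFReal_zero_sq, inv_pow, Real.sq_sqrt (by positivity)]
    ring
  · rw [corrCoeff_eq_zero_of_even isOddAE_signFun hn.add_one]
    have h0 := eval_neg_hermiteReal n 0
    rw [hn.neg_one_pow, neg_zero] at h0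
    have : (hermiteReal n).eval 0 = 0 := by linarith
    rw [this]
    simp

theorem corrCoeff_signFun_one : corrCoeff signFun signFun 1 = 2 / Real.pi := by
  rw [corrCoeff_signFun_succ 0]
  simp [hermiteReal_zero]

/-- The coefficient form of (1 - x²)h'' = xh', the equation satisfied by arcsine. It follows from
H_{n+2}(0) = -(n+1)H_n(0). -/
theorem corrCoeff_signFun_recurrence (n : ℕ) :
    ((n : ℝ) + 1) * (((n : ℝ) + 1 + 1) * corrCoeff signFun signFun (n + 1 + 1)) =
      (n : ℝ) ^ 2 * corrCoeff signFun signFun n := by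
  rcases n with _ | n
  · rw [corrCoeff_eq_zero_of_even isOddAE_signFun (ν := 0 + 1 + 1) (by decide)]
    simp
  · rw [corrCoeff_signFun_succ (n + 1 + 1), corrCoeff_signFun_succ n, eval_zero_hermiteReal_add_two,
      Nat.factorial_succ (n + 1 + 1), Nat.factorial_succ (n + 1)]
    push_cast
    have h0 : ((n + 1)! : ℝ) ≠ 0 := by positivity
    have h1 : (n : ℝ) + 1 + 1 ≠ 0 := by positivity
    have h2 : (n : ℝ) + 1 + 1 + 1 ≠ 0 := by positivity
    field_simp

/-- A power series whose coefficients satisfy the recurrence of the inverse sine. -/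
theorem powerSum_eq_arcsin {p : ℕ → ℝ} {C : ℝ} (hb : ∀ n, |p n| ≤ C) (h0 : p 0 = 0)
    (hrec : ∀ n : ℕ, ((n : ℝ) + 1) * (((n : ℝ) + 1 + 1) * p (n + 1 + 1)) = (n : ℝ) ^ 2 * p n)
    {x : ℝ} (hx : x ∈ Ioo (-1 : ℝ) 1) : powerSum p x = p 1 * Real.arcsin x := by
  -- q and s are the coefficient sequences of the first and second derivatives.
  set q : ℕ → ℝ := fun n => ((n : ℝ) + 1) * p (n + 1) with hq
  set s : ℕ → ℝ := fun n => ((n : ℝ) + 1) * q (n + 1) with hs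
  have hC : 0 ≤ C := (abs_nonneg _).trans (hb 0)
  have hqb : ∀ n, |q n| ≤ C * ((n : ℝ) + 1) ^ 1 := by
    intro n
    rw [abs_mul, abs_of_nonneg (by positivity), mul_comm, pow_one]
    exact mul_le_mul_of_nonneg_right (hb _) (by positivity)
  have hse : ∀ n, s n = (n : ℝ) ^ 2 * p n := by
    intro n
    rw [← hrec n]
    simp only [hs, hq]
    push_cast
    ring
  have hsb : ∀ n, |s n| ≤ C * ((n : ℝ) + 1) ^ 2 := by
    intro n
    rw [hse, abs_mul, abs_of_nonneg (by positivity), mul_comm]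
    have : (0 : ℝ) ≤ n := Nat.cast_nonneg n
    exact mul_le_mul (hb _) (pow_le_pow_left₀ this (by linarith) 2) (by positivity) hC
  have hdp : ∀ y ∈ Ioo (-1 : ℝ) 1, HasDerivAt (powerSum p) (powerSum q y) y := fun y hy =>
    (hasDerivAt_powerSum (C := C) (k := 0) (by simpa using hb) hy).1
  have hdq : ∀ y ∈ Ioo (-1 : ℝ) 1, HasDerivAt (powerSum q) (powerSum s y) y := fun y hy =>
    (hasDerivAt_powerSum hqb hy).1
  have hode : ∀ y ∈ Ioo (-1 : ℝ) 1, (1 - y ^ 2) * powerSum s y = y * powerSum q y := by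
    intro y hy
    have sq' : Summable fun n => q n * y ^ n := (hasDerivAt_powerSum hqb hy).2
    have ss : Summable fun n => s n * y ^ n := (hasDerivAt_powerSum hsb hy).2
    have e1 : y * powerSum q y = ∑' n : ℕ, (n : ℝ) * p n * y ^ n := by
      have h1 : Summable fun n : ℕ => (n : ℝ) * p n * y ^ n := by
        refine (summable_nat_add_iff 1).1 ((sq'.mul_left y).congr fun n => ?_)
        simp only [hq]; push_cast; ring
      rw [h1.tsum_eq_zero_add, powerSum, ← tsum_mul_left]
      simp only [Nat.cast_zero, zero_mul, zero_add]
      congr 1; ext n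
      simp only [hq]; push_cast; ring
    have h1 : Summable fun n : ℕ => ((n : ℝ) * (n - 1)) * p n * y ^ n := by
      refine (summable_nat_add_iff 2).1 ((ss.mul_left (y ^ 2)).congr fun n => ?_)
      simp only [hs, hq]; push_cast; ring
    have e2 : y ^ 2 * powerSum s y = ∑' n : ℕ, ((n : ℝ) * (n - 1)) * p n * y ^ n := by
      rw [← h1.sum_add_tsum_nat_add 2, powerSum, ← tsum_mul_left]
      simp only [Finset.sum_range_succ, Finset.sum_range_zero, Nat.cast_zero, zero_mul, zero_add,
        Nat.cast_one, sub_self, mul_zero]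
      congr 1; ext n
      simp only [hs, hq]; push_cast; ring
    rw [sub_mul, one_mul, e1, e2, powerSum, ← ss.tsum_sub h1]
    congr 1; ext n
    rw [hse]; ring
  have hpos : ∀ y ∈ Ioo (-1 : ℝ) 1, 0 < 1 - y ^ 2 := fun y hy => by nlinarith [hy.1, hy.2]
  have z0 : (0 : ℝ) ∈ Ioo (-1 : ℝ) 1 := by norm_num
  -- By the differential equation √(1 - y²) h'(y) is constant, equal to its value p_1 at 0; hence h'
  -- = p_1 arcsin'.
  have hdw : ∀ y ∈ Ioo (-1 : ℝ) 1,
      HasDerivAt (fun y => √(1 - y ^ 2) * powerSum q y) 0 y := by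
    intro y hy
    have hp := hpos y hy
    have h1 : HasDerivAt (fun y : ℝ => √(1 - y ^ 2)) (-(2 * y) / (2 * √(1 - y ^ 2))) y := by
      refine HasDerivAt.sqrt ?_ hp.ne'
      simpa using (hasDerivAt_pow 2 y).const_sub 1
    refine (h1.mul (hdq y hy)).congr_deriv ?_
    have hsq : √(1 - y ^ 2) ≠ 0 := (Real.sqrt_pos.2 hp).ne'
    have hsq2 : √(1 - y ^ 2) ^ 2 = 1 - y ^ 2 := Real.sq_sqrt hp.le
    field_simp
    rw [hsq2]
    linear_combination hode y hy
  have hw : ∀ y ∈ Ioo (-1 : ℝ) 1, √(1 - y ^ 2) * powerSum q y = p 1 := by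
    intro y hy
    rw [isOpen_Ioo.is_const_of_deriv_eq_zero isPreconnected_Ioo
      (fun z hz => (hdw z hz).differentiableAt.differentiableWithinAt)
      (fun z hz => (hdw z hz).deriv) hy z0, powerSum_zero]
    simp [hq]
  have hdz : ∀ y ∈ Ioo (-1 : ℝ) 1,
      HasDerivAt (fun y => powerSum p y - p 1 * Real.arcsin y) 0 y := by
    intro y hy
    have hsq : √(1 - y ^ 2) ≠ 0 := (Real.sqrt_pos.2 (hpos y hy)).ne'
    have h := (hdp y hy).sub ((Real.hasDerivAt_arcsin hy.1.ne' hy.2.ne).const_mul (p 1))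
    refine h.congr_deriv ?_
    rw [← hw y hy]
    field_simp
    ring
  have := isOpen_Ioo.is_const_of_deriv_eq_zero isPreconnected_Ioo
      (fun z hz => (hdz z hz).differentiableAt.differentiableWithinAt)
      (fun z hz => (hdz z hz).deriv) hx z0
  simp only [powerSum_zero, h0, Real.arcsin_zero, mul_zero, sub_zero] at this
  linarith

theorem isOddProbSeries_corrCoeff {k : ℕ} {f : (Fin k → ℝ) → ℝ} (hf : MemLp f ∞ (gaussMeasure k))
    (h2 : eLpNorm f 2 (gaussMeasure k) = 1) (ho : IsOddAE f) :
    IsOddProbSeries (corrCoeff f f) where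
  nonneg := corrCoeff_nonneg f
  hasSum := hasSum_corrCoeff_one hf h2
  even _ hn := corrCoeff_eq_zero_of_even ho hn
  lt_one := corrCoeff_one_lt_one hf h2

/-! ### Arcsine, sine and hyperbolic sine for the sign function. -/

theorem isOddProbSeries_signFun : IsOddProbSeries (corrCoeff signFun signFun) :=
  isOddProbSeries_corrCoeff memLp_top_signFun (eLpNorm_signFun two_ne_zero) isOddAE_signFun

theorem corrFun_signFun {x : ℝ} (hx : x ∈ Ioo (-1 : ℝ) 1) :
    powerSum (corrCoeff signFun signFun) x = 2 / Real.pi * Real.arcsin x := by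
  have hp := isOddProbSeries_signFun
  rw [← corrCoeff_signFun_one]
  refine powerSum_eq_arcsin (C := 1) (fun n => ?_) (hp.even 0 (by simp))
    corrCoeff_signFun_recurrence hx
  rw [abs_of_nonneg (hp.nonneg n)]
  exact le_hasSum hp.hasSum n fun _ _ => hp.nonneg _

theorem invUnit_corrFun_signFun {x : ℝ} (hx : x ∈ Ioo (-1 : ℝ) 1) :
    invUnit (powerSum (corrCoeff signFun signFun)) x = Real.sin (Real.pi / 2 * x) := by
  have hpi := Real.pi_pos
  have h1 : -(Real.pi / 2) < Real.pi / 2 * x := by nlinarith [hx.1]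
  have h2 : Real.pi / 2 * x < Real.pi / 2 := by nlinarith [hx.2]
  have hs : Real.sin (Real.pi / 2 * x) ∈ Ioo (-1 : ℝ) 1 := by
    constructor
    · have : Real.sin (-(Real.pi / 2)) = -1 := by simp
      rw [← this]
      exact Real.strictMonoOn_sin ⟨le_rfl, by linarith⟩ ⟨h1.le, h2.le⟩ h1
    · rw [← Real.sin_pi_div_two]
      exact Real.strictMonoOn_sin ⟨h1.le, h2.le⟩ ⟨by linarith, le_rfl⟩ h2
  have h := corrFun_signFun hs
  rw [Real.arcsin_sin h1.le h2.le] at h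
  have e : 2 / Real.pi * (Real.pi / 2 * x) = x := by field_simp
  rw [e] at h
  conv_lhs => rw [← h]
  exact isOddProbSeries_signFun.invUnit_powerSum (Ioo_subset_Icc_self hs)

theorem maclaurinCoeff_invUnit_signFun_odd (n : ℕ) :
    maclaurinCoeff (invUnit (powerSum (corrCoeff signFun signFun))) (2 * n + 1) =
      (-1) ^ n * ((Real.pi / 2) ^ (2 * n + 1) / ((2 * n + 1)! : ℝ)) := by
  have h : invUnit (powerSum (corrCoeff signFun signFun)) =ᶠ[nhds 0]
      fun x => Real.sin (Real.pi / 2 * x) := by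
    filter_upwards [Ioo_mem_nhds (show (-1 : ℝ) < 0 by norm_num) one_pos] with x hx
    exact invUnit_corrFun_signFun hx
  rw [maclaurinCoeff, h.iteratedDeriv_eq, iteratedDeriv_comp_const_mul Real.contDiff_sin,
    Real.iteratedDeriv_odd_sin]
  simp
  ring

theorem completelyRealAnalytic_invUnit_signFun :
    CompletelyRealAnalytic 1 (invUnit (powerSum (corrCoeff signFun signFun))) := by
  constructor
  · have h : AnalyticOnNhd ℝ (fun x => Real.sin (Real.pi / 2 * x)) (Ioo (-1) 1) := fun x _ => by
      fun_prop
    exact h.congr isOpen_Ioo fun x hx => (invUnit_corrFun_signFun hx).symm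
  -- The absolute coefficients are those of sinh(πx/2), so their sum is sinh(π/2).
  · have h : HasSum (fun n => |maclaurinCoeff (invUnit (powerSum (corrCoeff signFun signFun))) n|)
        (0 + Real.sinh (Real.pi / 2)) := by
      refine HasSum.even_add_odd ?_ ?_
      · simp only [isOddProbSeries_signFun.maclaurinCoeff_invUnit_even _ (even_two_mul _), abs_zero]
        exact hasSum_zero
      · convert Real.hasSum_sinh (Real.pi / 2) using 2 with n
        rw [maclaurinCoeff_invUnit_signFun_odd, abs_mul, abs_pow, abs_neg, abs_one, one_pow,
          one_mul, abs_of_nonneg (by positivity)]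
    simpa only [one_pow, mul_one, maclaurinCoeff] using h.summable

theorem isInvertibleSeries_signFun : IsInvertibleSeries (corrCoeff signFun signFun) :=
  ⟨isOddProbSeries_signFun, completelyRealAnalytic_invUnit_signFun⟩

theorem absSeries_invUnit_signFun {x : ℝ} (hx : x ∈ Icc (-1 : ℝ) 1) :
    absSeries (invUnit (powerSum (corrCoeff signFun signFun))) x =
      Real.sinh (Real.pi / 2 * x) := by
  have hp := isInvertibleSeries_signFun
  have h : HasSum (fun n => absInvCoeff (corrCoeff signFun signFun) n * x ^ n)
      (0 + Real.sinh (Real.pi / 2 * x)) := by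
    refine HasSum.even_add_odd ?_ ?_
    · simp only [hp.absInvCoeff_even _ (even_two_mul _), zero_mul]
      exact hasSum_zero
    · convert Real.hasSum_sinh (Real.pi / 2 * x) using 2 with n
      rw [absInvCoeff, maclaurinCoeff_invUnit_signFun_odd, abs_mul, abs_pow, abs_neg, abs_one,
        one_pow, one_mul, abs_of_nonneg (by positivity)]
      ring
  rw [zero_add] at h
  exact (hp.hasSum_absSeries hx).unique h

theorem hypTransform_signFun_one :
    hypTransform (powerSum (corrCoeff signFun signFun)) 1 =
      2 / Real.pi * Real.log (1 + √2) := by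
  have hp := isInvertibleSeries_signFun
  obtain ⟨hc0, hc1⟩ := hp.hyp_one_mem
  have h := hp.absSeries_hyp_one
  rw [absSeries_invUnit_signFun ⟨by linarith, hc1.le⟩] at h
  -- A(c) = 1 reads sinh(πc/2) = 1, and arsinh 1 = ln(1 + √2).
  have h2 := congrArg Real.arsinh h
  rw [Real.arsinh_sinh, Real.arsinh, one_pow, one_add_one_eq_two] at h2
  rw [← h2]
  field_simp

/-! ### The main theorem -/

theorem grothendieckConstant_le_linftyNorm_sq_div_hyp {k : ℕ} {f : (Fin k → ℝ) → ℝ}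
    (hf : MemLp f ∞ (gaussMeasure k)) (h1 : 1 ≤ linftyNorm f)
    (hp : IsInvertibleSeries (corrCoeff f f)) :
    grothendieckConstant ≤ linftyNorm f ^ 2 / hypTransform (corrFun f f) 1 :=
  csInf_le ⟨1, fun _ hK => one_le_of_mem_grothendieckAdmissible hK⟩
    (linftyNorm_sq_div_hyp_mem_grothendieckAdmissible hf h1 hp)

/-- Non-emptiness is Grothendieck's inequality itself; it comes from rounding with the sign
function. -/
theorem isLeast_grothendieckAdmissible :
    IsLeast grothendieckAdmissible grothendieckConstant :=
  isLeast_grothendieckConstant ⟨_, linftyNorm_sq_div_hyp_mem_grothendieckAdmissible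
    memLp_top_signFun linftyNorm_signFun.ge isInvertibleSeries_signFun⟩

theorem one_le_grothendieckConstant : 1 ≤ grothendieckConstant :=
  one_le_of_mem_grothendieckAdmissible isLeast_grothendieckAdmissible.1

theorem pi_div_two_mul_le_absSeries {k : ℕ} {f : (Fin k → ℝ) → ℝ}
    (hf : MemLp f ∞ (gaussMeasure k)) (h1 : 1 ≤ linftyNorm f)
    (hp : IsInvertibleSeries (corrCoeff f f)) {y : ℝ} (hy : y ∈ Icc (0 : ℝ) 1) :
    Real.pi / 2 * (1 / linftyNorm f ^ 2) * y ≤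
      absSeries (invUnit (powerSum (corrCoeff f f))) y := by
  refine le_trans (mul_le_mul_of_nonneg_right ?_ hy.1) (hp.inv_coeff_one_mul_le hy)
  have hM : 0 < linftyNorm f := one_pos.trans_le h1
  have h2 : Real.pi / 2 * (1 / linftyNorm f ^ 2) = (2 / Real.pi * linftyNorm f ^ 2)⁻¹ := by
    rw [mul_inv, inv_div, one_div]
  rw [h2]
  exact inv_anti₀ hp.coeff_one_pos (corrCoeff_one_le hf)

/-- K ≤ 1/c ≤ A(1) puts K in the range of A, so γ* is the hyperbolic transform of K. Strict
monotonicity of A gives both uniqueness and the lower bounds on γ*. -/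
theorem existsUnique_grothendieckConstant_eq {k : ℕ} {f : (Fin k → ℝ) → ℝ}
    (hf : MemLp f ∞ (gaussMeasure k)) (hp : IsInvertibleSeries (corrCoeff f f))
    (hM : linftyNorm f = 1) :
    ∃ γ ∈ Ioc (0 : ℝ) 1,
      grothendieckConstant = absSeries (invUnit (corrFun f f)) γ ∧
      (∀ γ' ∈ Ioc (0 : ℝ) 1,
        grothendieckConstant = absSeries (invUnit (corrFun f f)) γ' → γ' = γ) ∧
      grothendieckConstant ≤
        min (1 / hypTransform (corrFun f f) 1) (absSeries (invUnit (corrFun f f)) 1) ∧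
      (∀ c : ℝ, 1 ≤ c → c < grothendieckConstant →
        0 < hypTransform (corrFun f f) c ∧ hypTransform (corrFun f f) c < 1 ∧
        γ ∈ Ioc (hypTransform (corrFun f f) c) 1) := by
  have hK := grothendieckConstant_le_linftyNorm_sq_div_hyp hf hM.ge hp
  rw [hM, one_pow] at hK
  simp only [corrFun_eq_powerSum] at hK ⊢
  obtain ⟨hc0, hc1⟩ := hp.hyp_one_mem
  have hle : 1 / hypTransform (powerSum (corrCoeff f f)) 1 ≤
      absSeries (invUnit (powerSum (corrCoeff f f))) 1 := by
    rw [div_le_iff₀ hc0, mul_comm]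
    exact hp.absSeries_hyp_one.ge.trans (hp.absSeries_le_mul ⟨hc0.le, hc1.le⟩)
  have hK1 := one_le_grothendieckConstant
  have hKm : grothendieckConstant ∈
      Ioc (0 : ℝ) (absSeries (invUnit (powerSum (corrCoeff f f))) 1) :=
    ⟨one_pos.trans_le hK1, hK.trans hle⟩
  have hγ := hp.absSeries_hyp (Ioc_subset_Icc_self hKm)
  have hγm := hp.hyp_mem (Ioc_subset_Icc_self hKm)
  refine ⟨hypTransform (powerSum (corrCoeff f f)) grothendieckConstant,
    ⟨hp.hyp_pos hKm, hγm.2⟩, hγ.symm, fun γ' hγ' h => ?_, le_min hK (hK.trans hle),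
    fun c h1c hcK => ?_⟩
  · exact hp.strictMonoOn.injOn ⟨by linarith [hγ'.1], hγ'.2⟩ hγm (h.symm.trans hγ.symm)
  · have hcm : c ∈ Ioo (0 : ℝ) (absSeries (invUnit (powerSum (corrCoeff f f))) 1) :=
      ⟨by linarith, hcK.trans_le hKm.2⟩
    refine ⟨hp.hyp_pos (Ioo_subset_Ioc_self hcm), hp.hyp_lt_one (Ioo_subset_Ico_self hcm), ?_,
      hγm.2⟩
    rw [← hp.strictMonoOn.lt_iff_lt (hp.hyp_mem (Ioo_subset_Icc_self hcm)) hγm, hγ,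
      hp.absSeries_hyp (Ioo_subset_Icc_self hcm)]
    exact hcK

theorem mainTheorem2 :
    -- the real Grothendieck constant is well defined
    IsLeast grothendieckAdmissible grothendieckConstant ∧
    (∀ (k : ℕ) (_ : 1 ≤ k) (f : (Fin k → ℝ) → ℝ) (_ : MemLp f ∞ (gaussMeasure k))
      (_ : eLpNorm f 2 (gaussMeasure k) = 1),
      1 ≤ linftyNorm f ∧
      (IsOddAE f →
        -- the inverse of `h_{f,f}` is well defined on `[-1, 1]`
        BijOn (corrFun f f) (Icc (-1) 1) (Icc (-1) 1) ∧
        (CompletelyRealAnalytic 1 (invUnit (corrFun f f)) →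
          -- the hyperbolic transform is well defined, on an interval containing `[-1, 1]`
          (1 < absSeries (invUnit (corrFun f f)) 1 ∧
            BijOn (absSeries (invUnit (corrFun f f))) (Icc (-1) 1)
              (Icc (-absSeries (invUnit (corrFun f f)) 1)
                (absSeries (invUnit (corrFun f f)) 1))) ∧
          -- the linear lower bound
          (∀ y ∈ Icc (0 : ℝ) 1, Real.pi / 2 * (1 / linftyNorm f ^ 2) * y ≤
            absSeries (invUnit (corrFun f f)) y) ∧
          -- the upper bound of the Grothendieck constant
          (0 < hypTransform (corrFun f f) 1 ∧
            grothendieckConstant ≤ linftyNorm f ^ 2 / hypTransform (corrFun f f) 1) ∧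
          -- the upper bound under the sign condition
          ((∀ n : ℕ, Real.sign (iteratedDeriv (2 * n + 1) (invUnit (corrFun f f)) 0) =
              (-1) ^ n) →
            ((linftyNorm f ^ 2 / hypTransform (corrFun f f) 1 : ℝ) : ℂ) =
              Complex.I * ((linftyNorm f ^ 2 : ℝ) : ℂ) /
                complexSeries (corrFun f f) Complex.I ∧
            grothendieckConstant ≤
              (Complex.I * ((linftyNorm f ^ 2 : ℝ) : ℂ) /
                complexSeries (corrFun f f) Complex.I).re) ∧
          -- the case of norm one
          (linftyNorm f = 1 →
            ∃ γ ∈ Ioc (0 : ℝ) 1,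
              grothendieckConstant = absSeries (invUnit (corrFun f f)) γ ∧
              (∀ γ' ∈ Ioc (0 : ℝ) 1,
                grothendieckConstant = absSeries (invUnit (corrFun f f)) γ' → γ' = γ) ∧
              grothendieckConstant ≤
                min (1 / hypTransform (corrFun f f) 1) (absSeries (invUnit (corrFun f f)) 1) ∧
              (∀ c : ℝ, 1 ≤ c → c < grothendieckConstant →
                0 < hypTransform (corrFun f f) c ∧ hypTransform (corrFun f f) c < 1 ∧
                γ ∈ Ioc (hypTransform (corrFun f f) c) 1))))) ∧
    -- Krivine's bound, from the sign function
    (MemLp signFun ∞ (gaussMeasure 1) ∧ eLpNorm signFun 2 (gaussMeasure 1) = 1 ∧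
      linftyNorm signFun = 1 ∧ IsOddAE signFun ∧
      CompletelyRealAnalytic 1 (invUnit (corrFun signFun signFun)) ∧
      1 / hypTransform (corrFun signFun signFun) 1 = Real.pi / (2 * Real.log (1 + √2)) ∧
      grothendieckConstant ≤ Real.pi / (2 * Real.log (1 + √2))) := by
  have hK : 1 / hypTransform (corrFun signFun signFun) 1 =
      Real.pi / (2 * Real.log (1 + √2)) := by
    rw [corrFun_eq_powerSum, hypTransform_signFun_one, one_div, mul_inv, inv_div,
      ← div_eq_mul_inv, div_div]
  refine ⟨isLeast_grothendieckAdmissible, ?_, memLp_top_signFun, eLpNorm_signFun two_ne_zero,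
    linftyNorm_signFun, isOddAE_signFun, completelyRealAnalytic_invUnit_signFun, hK, ?_⟩
  · intro k _ f hf h2
    have h1 := one_le_linftyNorm hf h2
    refine ⟨h1, fun ho => ?_⟩
    have hp0 := isOddProbSeries_corrCoeff hf h2 ho
    refine ⟨hp0.bijOn, fun ha => ?_⟩
    have hp : IsInvertibleSeries (corrCoeff f f) := ⟨hp0, ha⟩
    have hle := grothendieckConstant_le_linftyNorm_sq_div_hyp hf h1 hp
    refine ⟨⟨hp.one_lt_absSeries_one, hp.bijOn_absSeries⟩,
      fun y hy => pi_div_two_mul_le_absSeries hf h1 hp hy, ⟨hp.hyp_one_mem.1, hle⟩, fun hs => ?_,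
      existsUnique_grothendieckConstant_eq hf hp⟩
    have he : ((linftyNorm f ^ 2 / hypTransform (corrFun f f) 1 : ℝ) : ℂ) =
        Complex.I * ((linftyNorm f ^ 2 : ℝ) : ℂ) / complexSeries (corrFun f f) Complex.I := by
      rw [corrFun_eq_powerSum, complexSeries_powerSum hp.summable_norm, hp.powerSum_I_of_sign hs,
        mul_div_mul_left _ _ Complex.I_ne_zero, Complex.ofReal_div]
    -- The complex quotient is in fact a real number, so passing to its real part loses nothing.
    refine ⟨he, ?_⟩
    rw [← he, Complex.ofReal_re]
    exact hle
  · have h := grothendieckConstant_le_linftyNorm_sq_div_hyp memLp_top_signFun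
      linftyNorm_signFun.ge isInvertibleSeries_signFun
    rwa [linftyNorm_signFun, one_pow, hK] at h
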